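/- **Setting.** Let $1\le K\le L$ be integers and let $E=\{1,\dots,L\}$ be a set of items with attraction probabilities $1\ge\bar w(1)\ge\dots\ge\bar w(L)\ge 0$. Put $\Delta_{e,K}=\bar w(K)-\bar w(e)$ and assume $\Delta_{e,K}>0$ for all $e>K$. The weights $w_t(e)$ ($t=0,1,2,\dots$, $e\in E$) are mutually independent Bernoulli variables with means $\bar w(e)$. For a list $A=(a_1,\dots,a_K)$ of distinct items the reward is $f(A,w)=1-\prod_{k=1}^K(1-w(a_k))$, and $A^\ast$ is a list that maximizes $f(\cdot,\bar w)$. **Algorithm** (Cascading-UCB with the Gaussian mechanism). Let $\epsilon>0$, $0<\delta<1$ and $\sigma=\frac1\epsilon\sqrt{2K\ln\frac{1.25}{\delta}}$. Start with $T_0(e)=1$ and $\hat w(e)=w_0(e)$ for all $e\in E$. At each round $t=1,2,\dots$ compute $$U_t(e)=\hat w(e)+\sqrt{\frac{1.5\log t}{T_{t-1}(e)}}+\sigma\sqrt{\frac{2\log(2t^3)}{T_{t-1}(e)}}\qquad(e\in E),$$ and recommend a list $A_t=(a^t_1,\dots,a^t_K)$ of $K$ items with the largest values of $U_t$ (in any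 order, ties broken by any measurable rule that depends on $t$ and $U_t$ only). Observe the click $C_t=\min\{k\le K: w_t(a^t_k)=1\}$, with $C_t=\infty$ if there is no such $k$. For $k=1,\dots,\min\{C_t,K\}$ and $e=a^t_k$ set $T_t(e)=T_{t-1}(e)+1$ and replace $\hat w(e)$ by $$\frac{T_{t-1}(e)\,\hat w(e)+\mathbb 1\{C_t=k\}+Z_t(e)}{T_t(e)},$$ where the noises $Z_t(e)\sim\mathcal N(0,\sigma^2)$ are independent of each other and of all the weights; the other items keep their counters and means. The regret is $R(T)=\mathbb E\big[\sum_{t=1}^T\big(f(A^\ast,w_t)-f(A_t,w_t)\big)\big]$. **Theorem.** (a) For every integer $T>1$, $$R(T)\le B(T):=\sum_{e=K+1}^L\frac{2\Big(2\sqrt{1.5}+\frac8\epsilon\sqrt{K\log\frac{1.25}{\delta}}\Big)^2}{\Delta_{e,K}}\log T .$$ (b) $B(T)=\mathcal O\Big(\sum_{e=K+1}^L\frac{K\log(1/\delta)}{\epsilon^2\Delta_{e,K}}\log T\Big)$: for all $\epsilon_0>0$ and $\delta_0\in(0,1)$ there is a constant $C>0$, depending only on $\epsilon_0$ and $\delta_0$,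 such that $B(T)\le C\sum_{e=K+1}^L\frac{K\log(1/\delta)}{\epsilon^2\Delta_{e,K}}\log T$ for all $L$, $K$, $\bar w$ as above, all $0<\epsilon\le\epsilon_0$, all $0<\delta\le\delta_0$ and all integers $T>1$. In particular the regret bound is linear, not quadratic, in $K$. -/

import Mathlib

namespace CascadingBandit

open MeasureTheory ProbabilityTheory

noncomputable section

/-- Reward of the list `A` (of `K` distinct items out of `L`) under the weights `w`:
`f(A, w) = 1 - ∏ₖ (1 - w(aₖ))`. -/
def reward {L K : ℕ} (A : Fin K ↪ Fin L) (w : Fin L → ℝ) : ℝ :=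
  1 - ∏ k, (1 - w (A k))

open Classical in
/-- The click: the first position of the list whose item has weight `1`, and `⊤` (that is, `∞`)
if there is none. -/
def click {L K : ℕ} (A : Fin K ↪ Fin L) (w : Fin L → ℝ) : WithTop (Fin K) :=
  (Finset.univ.filter fun k => w (A k) = 1).min

/-- Item `e` is observed: it stands in the list at a position `k ≤ min {C, K}`. -/
def Observed {L K : ℕ} (A : Fin K ↪ Fin L) (w : Fin L → ℝ) (e : Fin L) : Prop :=
  ∃ k, A k = e ∧ (k : WithTop (Fin K)) ≤ click A w

/-- Item `e` is clicked: it stands in the list at the position `k = C`. -/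
def Clicked {L K : ℕ} (A : Fin K ↪ Fin L) (w : Fin L → ℝ) (e : Fin L) : Prop :=
  ∃ k, A k = e ∧ click A w = (k : WithTop (Fin K))

/-- What the algorithm stores: for each item the counter `T(e)` and the noisy mean `ŵ(e)`. -/
structure State (L : ℕ) where
  /-- number of observations of each item -/
  count : Fin L → ℕ
  /-- noisy empirical mean of each item -/
  mean : Fin L → ℝ

/-- Initialization with the initial observation `w₀`: `T₀(e) = 1`, `ŵ(e) = w₀(e)`. -/
def State.init {L : ℕ} (w₀ : Fin L → ℝ) : State L where
  count _ := 1
  mean := w₀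

/-- Private upper confidence bound of item `e` at round `t`, computed from the state `s` at the
end of round `t - 1`. -/
def State.ucb {L : ℕ} (σ : ℝ) (t : ℕ) (s : State L) (e : Fin L) : ℝ :=
  s.mean e + √(1.5 * Real.log t / s.count e) + σ * √(2 * Real.log (2 * (t : ℝ) ^ 3) / s.count e)

open Classical in
/-- Update of the state in a round with list `A`, weights `w` and noise `z`: only observed items
are updated, and the update uses the feedback `1{C = k}` and the noise of that observation. -/
def State.update {L K : ℕ} (A : Fin K ↪ Fin L) (w z : Fin L → ℝ) (s : State L) : State L where
  count e := if Observed A w e then s.count e + 1 else s.count e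
  mean e :=
    if Observed A w e then
      (s.count e * s.mean e + (if Clicked A w e then 1 else 0) + z e) / ((s.count e : ℝ) + 1)
    else s.mean e

/-- A rule that picks, at round `t` and for the index vector `U`, a list of `K` items with the
largest indices. The order within the list and the way ties are broken are arbitrary. -/
structure IsTopKRule {L K : ℕ} (sel : ℕ → (Fin L → ℝ) → (Fin K ↪ Fin L)) : Prop where
  measurable : ∀ t A, MeasurableSet {U | sel t U = A}
  top : ∀ t U k e, e ∉ Set.range (sel t U) → U e ≤ U (sel t U k)

/-- State at the end of round `t` on the weight sequence `w` and the noise sequence `z`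
(`z t e` is the noise that is added if item `e` is observed at round `t`). -/
def state {L K : ℕ} (sel : ℕ → (Fin L → ℝ) → (Fin K ↪ Fin L)) (σ : ℝ)
    (w z : ℕ → Fin L → ℝ) : ℕ → State L
  | 0 => State.init (w 0)
  | t + 1 =>
    (state sel σ w z t).update (sel (t + 1) ((state sel σ w z t).ucb σ (t + 1)))
      (w (t + 1)) (z (t + 1))

/-- The list `A_t` recommended at round `t ≥ 1`. -/
def action {L K : ℕ} (sel : ℕ → (Fin L → ℝ) → (Fin K ↪ Fin L)) (σ : ℝ)
    (w z : ℕ → Fin L → ℝ) (t : ℕ) : Fin K ↪ Fin L :=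
  sel t ((state sel σ w z (t - 1)).ucb σ t)

/-- Standard deviation of the Gaussian noise, `σ = (1/ε) √(2 K ln(1.25/δ))`. -/
def noiseStd (K : ℕ) (ε δ : ℝ) : ℝ :=
  1 / ε * √(2 * K * Real.log (1.25 / δ))

/-- The stochastic model: the weights `W t e` (`t = 0` is the initial observation) are Bernoulli
with means `wbar e`, the noises `Z t e` are centred Gaussian with standard deviation `σ`, and all
of these random variables are mutually independent. -/
structure IsModel {Ω : Type*} [MeasurableSpace Ω] (μ : Measure Ω) {L : ℕ}
    (wbar : Fin L → unitInterval) (σ : ℝ) (W Z : ℕ → Fin L → Ω → ℝ) : Prop where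
  measurable_weight : ∀ t e, Measurable (W t e)
  measurable_noise : ∀ t e, Measurable (Z t e)
  law_weight : ∀ t e, μ.map (W t e) = bernoulliMeasure (1 : ℝ) 0 (wbar e)
  law_noise : ∀ t e, μ.map (Z t e) = gaussianReal 0 (σ ^ 2).toNNReal
  indep : iIndepFun
    (Sum.elim (fun p : ℕ × Fin L => W p.1 p.2) (fun p : ℕ × Fin L => Z p.1 p.2)) μ

/-- `Astar` is an optimal list: it maximizes `f(·, w̄)` over all lists. -/
def IsOptimal {L K : ℕ} (wbar : Fin L → unitInterval) (Astar : Fin K ↪ Fin L) : Prop :=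
  ∀ A : Fin K ↪ Fin L, reward A (fun e => (wbar e : ℝ)) ≤ reward Astar (fun e => (wbar e : ℝ))

/-- Sum over the rounds `1, …, T` of the stochastic regrets `f(A*, w_t) - f(A_t, w_t)`, on the
outcome `ω`. -/
def cumulativeRegret {Ω : Type*} {L K : ℕ} (sel : ℕ → (Fin L → ℝ) → (Fin K ↪ Fin L)) (σ : ℝ)
    (W Z : ℕ → Fin L → Ω → ℝ) (Astar : Fin K ↪ Fin L) (T : ℕ) (ω : Ω) : ℝ :=
  ∑ t ∈ Finset.Icc 1 T,
    (reward Astar (fun e => W t e ω) -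
      reward (action sel σ (fun s e => W s e ω) (fun s e => Z s e ω) t) (fun e => W t e ω))

/-- The `K`-th item, in the numbering of the items by `Fin L` that starts at `0`. -/
def kth {L K : ℕ} (hK : 1 ≤ K) (hKL : K ≤ L) : Fin L := ⟨K - 1, by omega⟩

/-- The gap `Δ_{e,e'} = w̄(e') - w̄(e)`. -/
def gap {L : ℕ} (wbar : Fin L → unitInterval) (e e' : Fin L) : ℝ :=
  (wbar e' : ℝ) - (wbar e : ℝ)

/-- `∑_{e = K+1}^{L} 2 (2 √1.5 + (8/ε) √(K log(1.25/δ)))² / Δ_{e,K} · log T`. -/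
def regretBound {L K : ℕ} (hK : 1 ≤ K) (hKL : K ≤ L) (wbar : Fin L → unitInterval)
    (ε δ : ℝ) (T : ℕ) : ℝ :=
  ∑ e : Fin L with K ≤ e.val,
    2 * (2 * √1.5 + 8 / ε * √(K * Real.log (1.25 / δ))) ^ 2 / gap wbar e (kth hK hKL) * Real.log T

/-- `∑_{e = K+1}^{L} K log(1/δ) / (ε² Δ_{e,K}) · log T`. -/
def regretRate {L K : ℕ} (hK : 1 ≤ K) (hKL : K ≤ L) (wbar : Fin L → unitInterval)
    (ε δ : ℝ) (T : ℕ) : ℝ :=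
  ∑ e : Fin L with K ≤ e.val,
    K * Real.log (1 / δ) / (ε ^ 2 * gap wbar e (kth hK hKL)) * Real.log T

end

end CascadingBandit

namespace CascadingBandit

open MeasureTheory ProbabilityTheory

noncomputable section

/-! ### Sums of capped confidence widths -/

/-! Pair the recommended list with the first `K` items, matching common items with themselves.
Telescoping the difference of the two products writes the expected regret of a round as a sum over
positions of a gap, times the probability that the position is observed, times a factor at most `1`.
A suboptimal item thus pays only when it is observed (`listRegret_le`).

While the confidence bounds hold, a listed suboptimal item `e` and a missing optimal item differ by
at most twice the width at `e`, hence by at most `√(M / s)`, where `s` is the counter of `e` and `M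
= (2√1.5 + 2√8 σ)² log T`. Each value of `s` is charged at most once, so an item with gap `Δ` costs
at most `2 * M / Δ - M` in total (`sum_explorationCost_le`). The first term is the claimed bound;
the surplus `-M` pays for the first round and for failing confidence bounds, so no additive constant
remains.

A bound fails at round `t` with probability at most `t⁻²`, by an exponential supermartingale with
variance proxy `1/4 + σ²` (`IsModel.measureReal_fail_le`). There are `K` optimal items but only `L -
K` surpluses, so charging `1` for each failing optimal item would be too much. Each is charged
`missCost` instead, and these charges sum to at most `L - K + 1` (`sum_missCost_le`).

The bound is linear in `K` because `K` enters only through `σ²`. -/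

lemma sum_min_one_sqrt_le {M : ℝ} (hM : 0 < M) (N : ℕ) :
    ∀ θ : ℝ, 0 < θ → θ ≤ 1 →
      ∑ s ∈ Finset.Icc 1 N, min 1 √(M / s) ≤ θ * N + M / θ - M := by
  -- `θ` stays free so that the hypothesis can be used at `min 1 √(M / x)`, `x = N + 1`. This is the
  -- minimizer of `θ * x + M / θ` on `(0, 1]` and also the new summand.
  induction N with
  | zero =>
    intro θ h0 h1
    have : M ≤ M / θ := by
      rw [le_div_iff₀ h0]; nlinarith
    simp; linarith
  | succ N ih =>
    intro θ h0 h1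
    rw [Finset.sum_Icc_succ_top (by omega)]
    set x : ℝ := ((N + 1 : ℕ) : ℝ) with hx
    have hxN : (N : ℝ) = x - 1 := by simp [hx]
    have hxpos : 0 < x := by positivity
    rcases le_total 1 √(M / x) with h | h
    · rw [min_eq_left h]
      have hMx : x ≤ M := by
        have := (Real.one_le_sqrt).1 h
        rwa [le_div_iff₀ hxpos, one_mul] at this
      have h2 := ih 1 one_pos le_rfl
      have h3 : x + M ≤ θ * x + M / θ := by
        have : θ * x + M / θ - (x + M) = (1 - θ) * (M - θ * x) / θ := by field_simp; ring
        have h4 : 0 ≤ (1 - θ) * (M - θ * x) / θ := by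
          apply div_nonneg (mul_nonneg (by linarith) (by nlinarith)) h0.le
        linarith
      rw [hxN] at h2
      linarith
    · rw [min_eq_right h]
      have hr : 0 < √(M / x) := Real.sqrt_pos.2 (by positivity)
      have h2 := ih _ hr h
      have h3 : √(M / x) ^ 2 * x = M := by
        rw [Real.sq_sqrt (by positivity)]; field_simp
      set r := √(M / x)
      have h4 : r * x + M / r ≤ θ * x + M / θ := by
        have : θ * x + M / θ - (r * x + M / r) = (θ - r) ^ 2 * x / θ := by
          rw [← h3]; field_simp; ring
        have h5 : 0 ≤ (θ - r) ^ 2 * x / θ := by positivity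
        linarith
      rw [hxN] at h2
      linarith

/-- Cost charged to the `s`-th observation of an item with gap `Δ`: the confidence width
`√(M / s)`, capped at `1`, as long as it has not fallen below the gap. -/
def explorationCost (M Δ : ℝ) (s : ℕ) : ℝ :=
  if Δ ≤ √(M / s) then min 1 √(M / s) else 0

lemma explorationCost_nonneg (M Δ : ℝ) (s : ℕ) : 0 ≤ explorationCost M Δ s := by
  unfold explorationCost
  split_ifs
  · positivity
  · rfl

lemma explorationCost_le_one (M Δ : ℝ) (s : ℕ) : explorationCost M Δ s ≤ 1 := by
  unfold explorationCost
  split_ifs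
  · exact min_le_left _ _
  · exact zero_le_one

/-- The cost vanishes beyond `s = M / Δ ^ 2`, and `θ = Δ` in the previous bound gives `M / Δ` twice.
The gain `-M` is due to the cap at `1`. -/
lemma sum_explorationCost_le {M Δ : ℝ} (hM : 0 < M) (h0 : 0 < Δ) (h1 : Δ ≤ 1) (n : ℕ) :
    ∑ s ∈ Finset.Ico 1 n, explorationCost M Δ s ≤ 2 * M / Δ - M := by
  set N := ⌊M / Δ ^ 2⌋₊
  have key : ∑ s ∈ Finset.Ico 1 n, explorationCost M Δ s ≤
      ∑ s ∈ Finset.Icc 1 N, min 1 √(M / s) := by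
    unfold explorationCost
    rw [← Finset.sum_filter]
    apply Finset.sum_le_sum_of_subset_of_nonneg
    · intro s hs
      simp only [Finset.mem_filter, Finset.mem_Ico] at hs
      obtain ⟨⟨hs1, -⟩, hs2⟩ := hs
      have hspos : (0 : ℝ) < s := by exact_mod_cast hs1
      rw [Finset.mem_Icc]
      refine ⟨hs1, Nat.le_floor ?_⟩
      rw [Real.le_sqrt h0.le (by positivity), le_div_iff₀ hspos] at hs2
      rw [le_div_iff₀ (by positivity)]
      linarith
    · intros; positivity
  refine key.trans ((sum_min_one_sqrt_le hM N Δ h0 h1).trans ?_)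
  have : (N : ℝ) ≤ M / Δ ^ 2 := Nat.floor_le (by positivity)
  have h2 : Δ * N ≤ Δ * (M / Δ ^ 2) := by gcongr
  have h3 : Δ * (M / Δ ^ 2) = M / Δ := by field_simp
  have h4 : 2 * M / Δ = M / Δ + M / Δ := by ring
  linarith

/-! ### Observations and clicks -/

section Feedback

variable {L K : ℕ} {A : Fin K ↪ Fin L} {w : Fin L → ℝ}

lemma le_click_iff {k : Fin K} :
    (k : WithTop (Fin K)) ≤ click A w ↔ ∀ i < k, w (A i) ≠ 1 := by
  unfold click
  rw [Finset.min_eq_inf_withTop, Finset.le_inf_iff]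
  simp only [Finset.mem_filter, Finset.mem_univ, true_and, WithTop.coe_le_coe]
  constructor
  · intro h i hi hw
    exact absurd (h i hw) (not_le.2 hi)
  · intro h i hw
    by_contra hlt
    exact h i (not_le.1 hlt) hw

lemma observed_apply_iff {k : Fin K} : Observed A w (A k) ↔ ∀ i < k, w (A i) ≠ 1 := by
  rw [← le_click_iff]
  constructor
  · rintro ⟨j, hj, h⟩
    rwa [← A.injective hj]
  · exact fun h => ⟨k, rfl, h⟩

lemma Observed.mem_range {e : Fin L} (h : Observed A w e) : e ∈ Set.range A :=
  let ⟨k, hk, _⟩ := h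
  ⟨k, hk⟩

/-- An observed item stands no later than the click, so its feedback reveals its weight: the
algorithm averages genuine samples. -/
lemma Observed.clicked_iff {e : Fin L} (h : Observed A w e) : Clicked A w e ↔ w e = 1 := by
  obtain ⟨k, rfl, hk⟩ := h
  constructor
  · rintro ⟨j, hj, h⟩
    have := Finset.mem_of_min h
    rw [← hj]
    simpa using this
  · intro hw
    refine ⟨k, rfl, le_antisymm (Finset.min_le ?_) hk⟩
    simpa using hw

end Feedback

/-! ### Decomposition of the expected regret of one round -/

section Regret

variable {L K : ℕ}

/-- The identity on the common items extends to a bijection between positions and the first `K`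
items, as both sets have `K` elements. Positions of suboptimal items then receive optimal items
missing from the list. -/
lemma exists_pairing (hKL : K ≤ L) (A : Fin K ↪ Fin L) :
    ∃ b : Fin K ↪ Fin L, (∀ k, (b k).val < K) ∧ (∀ k, (A k).val < K → b k = A k) ∧
      (∀ k, K ≤ (A k).val → b k ∉ Set.range A) ∧
      Finset.univ.map b = Finset.univ.filter fun i : Fin L => i.val < K := by
  classical
  set t : Finset (Fin L) := Finset.univ.filter fun i : Fin L => i.val < K with ht
  have hcard : t.card = K := by
    simpa [ht, hKL] using Fin.card_filter_val_lt (n := L) (m := K)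
  obtain ⟨g, hg⟩ := Finset.exists_equiv_extend_of_card_eq (α := Fin K) (t := t)
    (s := Finset.univ.filter fun k => (A k).val < K) (f := A) (by simp [hcard])
    (by intro x hx; simp only [Finset.mem_image, Finset.mem_filter, Finset.mem_univ, true_and,
          ht] at hx ⊢; obtain ⟨k, hk, rfl⟩ := hx; exact hk)
    A.injective.injOn
  have hb : ∀ k, ((g k : Fin L)).val < K := fun k =>
    (Finset.mem_filter.1 (g k).2).2
  have hbA : ∀ k, (A k).val < K → (g k : Fin L) = A k := fun k hk => hg k (by simpa using hk)
  have hinj : Function.Injective fun k => (g k : Fin L) :=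
    Subtype.val_injective.comp g.injective
  refine ⟨⟨fun k => (g k : Fin L), hinj⟩, hb, hbA, ?_, ?_⟩
  · rintro k hk ⟨i, hi⟩
    have hi' : A i = (g k : Fin L) := hi
    have h1 : (A i).val < K := by rw [hi']; exact hb k
    have h2 : i = k := hinj ((hbA i h1).trans hi')
    subst h2
    omega
  · apply Finset.eq_of_subset_of_card_le
    · intro x hx
      obtain ⟨k, -, rfl⟩ := Finset.mem_map.1 hx
      exact (g k).2
    · simp [hcard]

/-- Probability that item `e` of the list `A` is observed. -/
def obsProb (p : Fin L → ℝ) (A : Fin K ↪ Fin L) (e : Fin L) : ℝ :=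
  ∑ k, if A k = e then ∏ i with i < k, (1 - p (A i)) else 0

lemma obsProb_apply (p : Fin L → ℝ) (A : Fin K ↪ Fin L) (k : Fin K) :
    obsProb p A (A k) = ∏ i with i < k, (1 - p (A i)) := by
  simp [obsProb]

lemma obsProb_of_notMem (p : Fin L → ℝ) {A : Fin K ↪ Fin L} {e : Fin L}
    (he : e ∉ Set.range A) : obsProb p A e = 0 :=
  Finset.sum_eq_zero fun k _ => if_neg fun h => he ⟨k, h⟩

/-- Expected regret of the list `A` against the list of the first `K` items. -/
def listRegret (p : Fin L → ℝ) (A : Fin K ↪ Fin L) : ℝ :=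
  ∏ k, (1 - p (A k)) - ∏ i : Fin L with i.val < K, (1 - p i)

lemma prod_filter_lt_le_prod (hKL : K ≤ L) {p : Fin L → ℝ} (hp : Antitone p)
    (hp1 : ∀ e, p e ≤ 1) (A : Fin K ↪ Fin L) :
    ∏ i : Fin L with i.val < K, (1 - p i) ≤ ∏ k, (1 - p (A k)) := by
  obtain ⟨b, hb, hbA, -, hmap⟩ := exists_pairing hKL A
  rw [← hmap, Finset.prod_map]
  refine Finset.prod_le_prod (fun k _ => by linarith [hp1 (b k)]) fun k _ => ?_
  rcases lt_or_ge (A k).val K with h | h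
  · rw [hbA k h]
  · have : b k ≤ A k := by
      rw [Fin.le_def]; exact ((hb k).trans_le h).le
    linarith [hp this]

lemma listRegret_le_one {p : Fin L → ℝ} (hp0 : ∀ e, 0 ≤ p e) (hp1 : ∀ e, p e ≤ 1)
    (A : Fin K ↪ Fin L) : listRegret p A ≤ 1 := by
  have h1 : ∏ k, (1 - p (A k)) ≤ 1 :=
    Finset.prod_le_one (fun k _ => by linarith [hp1 (A k)]) fun k _ => by linarith [hp0 (A k)]
  have h2 : 0 ≤ ∏ i : Fin L with i.val < K, (1 - p i) :=
    Finset.prod_nonneg fun i _ => by linarith [hp1 i]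
  unfold listRegret
  linarith

/-- The factors `1 - p i` grow with `i`, so the last `K - m` of the first `K` items give the largest
product. Off the common part, factors over `C` are at most `θ`, those over `D` at least `θ`, and
extra factors `θ ≤ 1` do no harm. -/
lemma prod_le_prod_filter_ge {p : Fin L → ℝ} (hp : Antitone p) (hp0 : ∀ e, 0 ≤ p e)
    (hp1 : ∀ e, p e ≤ 1) {m : ℕ} (hm : m < K) (hKL : K ≤ L) {C : Finset (Fin L)}
    (hCK : ∀ i ∈ C, i.val < K) (hC : K ≤ C.card + m) :
    ∏ i ∈ C, (1 - p i) ≤ ∏ i : Fin L with m ≤ i.val ∧ i.val < K, (1 - p i) := by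
  classical
  set D : Finset (Fin L) := Finset.univ.filter fun i : Fin L => m ≤ i.val ∧ i.val < K with hD
  have hDcard : D.card = K - m := by
    have : D = Finset.Ico (⟨m, by omega⟩ : Fin L) ⟨K - 1, by omega⟩ ∪ {⟨K - 1, by omega⟩} := by
      ext i
      simp only [hD, Finset.mem_filter, Finset.mem_univ, true_and, Finset.mem_union,
        Finset.mem_Ico, Finset.mem_singleton, Fin.le_def, Fin.lt_def, Fin.ext_iff]
      omega
    rw [this, Finset.card_union_of_disjoint (by simp)]
    simp; omega
  set θ := 1 - p ⟨m, by omega⟩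
  have hθ0 : 0 ≤ θ := by linarith [hp1 ⟨m, by omega⟩]
  have hθ1 : θ ≤ 1 := by linarith [hp0 ⟨m, by omega⟩]
  rw [← Finset.prod_inter_mul_prod_sdiff C D, ← Finset.prod_inter_mul_prod_sdiff D C,
    Finset.inter_comm D C]
  refine mul_le_mul_of_nonneg_left ?_ (Finset.prod_nonneg fun i _ => by linarith [hp1 i])
  have hcard : (D \ C).card ≤ (C \ D).card := by
    have h1 := Finset.card_sdiff_add_card_inter D C
    have h2 := Finset.card_sdiff_add_card_inter C D
    rw [Finset.inter_comm] at h2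
    omega
  calc ∏ i ∈ C \ D, (1 - p i) ≤ ∏ i ∈ C \ D, θ := by
        refine Finset.prod_le_prod (fun i _ => by linarith [hp1 i]) fun i hi => ?_
        rw [Finset.mem_sdiff] at hi
        have h1 := hCK i hi.1
        have h2 : ¬ (m ≤ i.val ∧ i.val < K) := by simpa [hD] using hi.2
        have h3 : i ≤ ⟨m, by omega⟩ := by rw [Fin.le_def]; simp only; omega
        linarith [hp h3]
    _ = θ ^ (C \ D).card := by simp
    _ ≤ θ ^ (D \ C).card := pow_le_pow_of_le_one hθ0 hθ1 hcard
    _ = ∏ i ∈ D \ C, θ := by simp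
    _ ≤ ∏ i ∈ D \ C, (1 - p i) := by
        refine Finset.prod_le_prod (fun i _ => hθ0) fun i hi => ?_
        rw [Finset.mem_sdiff] at hi
        have h2 : m ≤ i.val ∧ i.val < K := by simpa [hD] using hi.1
        have h3 : (⟨m, by omega⟩ : Fin L) ≤ i := by rw [Fin.le_def]; exact h2.1
        linarith [hp h3]

/-- Largest regret that a round can suffer on behalf of the optimal item `b`, when all but
`L - K` of the first `K` items are in the list. -/
def missCost (K : ℕ) (p : Fin L → ℝ) (b : Fin L) : ℝ :=
  p b * ∏ i : Fin L with L - K ≤ i.val ∧ i.val < K, (1 - p i)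

lemma missCost_nonneg {p : Fin L → ℝ} (hp0 : ∀ e, 0 ≤ p e) (hp1 : ∀ e, p e ≤ 1) (b : Fin L) :
    0 ≤ missCost K p b :=
  mul_nonneg (hp0 b) (Finset.prod_nonneg fun i _ => by linarith [hp1 i])

/-- The leading `L - K` items cost at most `1` each. For the others, with `S` the sum of their `p`,
the product is at most `exp (-S)`, and `S * exp (-S) ≤ 1`. -/
lemma sum_missCost_le (hKL : K ≤ L) {p : Fin L → ℝ} (hp0 : ∀ e, 0 ≤ p e)
    (hp1 : ∀ e, p e ≤ 1) :
    ∑ b : Fin L with b.val < K, missCost K p b ≤ (L - K : ℝ) + 1 := by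
  classical
  set D : Finset (Fin L) := Finset.univ.filter fun i : Fin L => L - K ≤ i.val ∧ i.val < K with hD
  set E : Finset (Fin L) := Finset.univ.filter fun i : Fin L => i.val < L - K with hE
  set P := ∏ i ∈ D, (1 - p i)
  have hP0 : 0 ≤ P := Finset.prod_nonneg fun i _ => by linarith [hp1 i]
  have hP1 : P ≤ 1 :=
    Finset.prod_le_one (fun i _ => by linarith [hp1 i]) fun i _ => by linarith [hp0 i]
  have hsub : (Finset.univ.filter fun b : Fin L => b.val < K) ⊆ E ∪ D := by
    intro i
    simp only [hD, hE, Finset.mem_filter, Finset.mem_univ, true_and, Finset.mem_union]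
    omega
  have hdisj : Disjoint E D := by
    rw [Finset.disjoint_left]
    intro i
    simp only [hD, hE, Finset.mem_filter, Finset.mem_univ, true_and]
    omega
  have hEs : ∑ b ∈ E, missCost K p b ≤ (L - K : ℝ) := by
    calc ∑ b ∈ E, missCost K p b ≤ ∑ b ∈ E, (1 : ℝ) :=
          Finset.sum_le_sum fun b _ => mul_le_one₀ (hp1 b) hP0 hP1
      _ = (L - K : ℝ) := by
          have : E.card = L - K := by
            simpa [hE] using Fin.card_filter_val_lt (n := L) (m := L - K)
          simp [this, Nat.cast_sub hKL]
  have hDs : ∑ b ∈ D, missCost K p b ≤ 1 := by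
    have h1 : ∑ b ∈ D, missCost K p b = (∑ b ∈ D, p b) * P := by
      rw [Finset.sum_mul]; rfl
    set S := ∑ b ∈ D, p b
    have hS : 0 ≤ S := Finset.sum_nonneg fun b _ => hp0 b
    have h2 : P ≤ Real.exp (-S) := by
      rw [← Finset.sum_neg_distrib, Real.exp_sum]
      exact Finset.prod_le_prod (fun i _ => by linarith [hp1 i]) fun i _ =>
        Real.one_sub_le_exp_neg _
    rw [h1]
    calc S * P ≤ S * Real.exp (-S) := by gcongr
      _ ≤ Real.exp S * Real.exp (-S) := by
          gcongr
          linarith [Real.add_one_le_exp S]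
      _ = 1 := by rw [← Real.exp_add]; simp
  calc ∑ b : Fin L with b.val < K, missCost K p b ≤ ∑ b ∈ E ∪ D, missCost K p b :=
        Finset.sum_le_sum_of_subset_of_nonneg hsub fun b _ _ => missCost_nonneg hp0 hp1 b
    _ = ∑ b ∈ E, missCost K p b + ∑ b ∈ D, missCost K p b := Finset.sum_union hdisj
    _ ≤ _ := add_le_add hEs hDs

lemma sum_embedding_le_sum {f : Fin L → ℝ} (hf : ∀ e, 0 ≤ f e) (A : Fin K ↪ Fin L) :
    ∑ k, f (A k) ≤ ∑ e, f e := by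
  rw [← Finset.sum_map Finset.univ A f]
  exact Finset.sum_le_sum_of_subset_of_nonneg (Finset.subset_univ _) fun e _ _ => hf e

open Classical in
/-- The regret of a round is charged to the observed suboptimal items (`G`), to the suboptimal
items whose confidence bound fails (`Fs`), and to the optimal items whose confidence bound
fails (`Fo`). -/
lemma listRegret_le (hKL : K ≤ L) {p : Fin L → ℝ} (hp : Antitone p) (hp0 : ∀ e, 0 ≤ p e)
    (hp1 : ∀ e, p e ≤ 1) (A : Fin K ↪ Fin L) (Fs Fo : Fin L → Prop) {G : Fin L → ℝ}
    (hG : ∀ e, 0 ≤ G e)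
    (hgood : ∀ e b : Fin L, K ≤ e.val → b.val < K → e ∈ Set.range A → b ∉ Set.range A →
      ¬ Fs e → ¬ Fo b → p b - p e ≤ G e) :
    listRegret p A ≤ ∑ e : Fin L with K ≤ e.val, obsProb p A e * G e +
      ∑ e : Fin L with K ≤ e.val, (if Fs e then 1 else 0) +
      ∑ b : Fin L with b.val < K, (if Fo b then missCost K p b else 0) := by
  obtain ⟨b, hb, hbA, hbA', hmap⟩ := exists_pairing hKL A
  have hq0 : ∀ e, 0 ≤ 1 - p e := fun e => by linarith [hp1 e]
  have hq1 : ∀ e, 1 - p e ≤ 1 := fun e => by linarith [hp0 e]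
  set pre : Fin K → ℝ := fun k => ∏ i with i < k, (1 - p (A i)) with hpre
  set post : Fin K → ℝ := fun k => ∏ i with k < i, (1 - p (b i)) with hpost
  have hpre0 : ∀ k, 0 ≤ pre k := fun k => Finset.prod_nonneg fun i _ => hq0 _
  have hpre1 : ∀ k, pre k ≤ 1 := fun k => Finset.prod_le_one (fun i _ => hq0 _) fun i _ => hq1 _
  have hpost0 : ∀ k, 0 ≤ post k := fun k => Finset.prod_nonneg fun i _ => hq0 _
  have hpost1 : ∀ k, post k ≤ 1 := fun k => Finset.prod_le_one (fun i _ => hq0 _) fun i _ => hq1 _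
  -- The prefix carries the items of `A`, so that `pre k` is exactly the probability that position
  -- `k` is observed.
  have hdecomp : listRegret p A = ∑ k, (p (b k) - p (A k)) * pre k * post k := by
    have := Finset.prod_add_ordered Finset.univ (fun k => 1 - p (b k))
      (fun k => p (b k) - p (A k))
    simp only [sub_add_sub_cancel] at this
    rw [listRegret, this, ← hmap, Finset.prod_map]
    simp [hpre, hpost]
  -- At most `L - K` positions hold suboptimal items. On the remaining positions `C` the lists agree
  -- and `k ∉ C`, so prefix and suffix together contain every factor over `C`.
  have hmiss : ∀ k, K ≤ (A k).val → p (b k) * (pre k * post k) ≤ missCost K p (b k) := by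
    intro k hk
    refine mul_le_mul_of_nonneg_left ?_ (hp0 _)
    set C : Finset (Fin K) := Finset.univ.filter fun i => (A i).val < K with hC
    have hCcard : K ≤ C.card + (L - K) := by
      have h1 : (Finset.univ.filter fun i => ¬ (A i).val < K).card ≤ L - K := by
        rw [← Finset.card_map A]
        calc _ ≤ (Finset.univ.filter fun e : Fin L => ¬ e.val < K).card := by
              apply Finset.card_le_card
              intro x hx
              obtain ⟨i, hi, rfl⟩ := Finset.mem_map.1 hx
              simpa using hi
          _ = L - K := by
              have h2 := Finset.card_filter_add_card_filter_not (s := Finset.univ)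
                (fun e : Fin L => e.val < K)
              have h3 : (Finset.univ.filter fun e : Fin L => e.val < K).card = K := by
                simpa [hKL] using Fin.card_filter_val_lt (n := L) (m := K)
              rw [h3, Finset.card_univ, Fintype.card_fin] at h2
              omega
      have h2 := Finset.card_filter_add_card_filter_not (s := Finset.univ)
        (fun i => (A i).val < K)
      rw [Finset.card_univ, Fintype.card_fin] at h2
      change C.card + _ = _ at h2
      omega
    have hkC : k ∉ C := by simpa [hC] using hk
    have hsplit : pre k * post k ≤ ∏ i ∈ C.map b, (1 - p i) := by
      rw [Finset.prod_map, ← Finset.prod_filter_mul_prod_filter_not C (fun i => i < k)]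
      have hf1 : ∏ i ∈ C.filter (fun i => i < k), (1 - p (b i)) =
          ∏ i ∈ C.filter (fun i => i < k), (1 - p (A i)) :=
        Finset.prod_congr rfl fun i hi => by
          rw [hbA i (by simpa [hC] using (Finset.mem_filter.1 hi).1)]
      rw [hf1]
      refine mul_le_mul ?_ ?_ (hpost0 k) (Finset.prod_nonneg fun i _ => hq0 _)
      · refine Finset.prod_le_prod_of_subset_of_le_one ?_ (fun i _ => hq0 _) fun i _ _ => hq1 _
        exact Finset.filter_subset_filter _ (Finset.subset_univ _)
      · refine Finset.prod_le_prod_of_subset_of_le_one ?_ (fun i _ => hq0 _) fun i _ _ => hq1 _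
        intro i hi
        rw [Finset.mem_filter] at hi
        have : i ≠ k := fun h => hkC (h ▸ hi.1)
        simp only [Finset.mem_filter, Finset.mem_univ, true_and]
        exact lt_of_le_of_ne (not_lt.1 hi.2) this.symm
    rcases lt_or_ge (L - K) K with hm | hm
    · refine hsplit.trans (prod_le_prod_filter_ge hp hp0 hp1 hm hKL ?_ (by simpa using hCcard))
      intro x hx
      obtain ⟨i, -, rfl⟩ := Finset.mem_map.1 hx
      exact hb i
    · rw [Finset.prod_eq_one]
      · exact mul_le_one₀ (hpre1 k) (hpost0 k) (hpost1 k)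
      · intro i hi
        simp only [Finset.mem_filter] at hi
        omega
  set fG : Fin L → ℝ := fun e => if K ≤ e.val then obsProb p A e * G e else 0
  set fs : Fin L → ℝ := fun e => if K ≤ e.val then (if Fs e then 1 else 0) else 0
  set fo : Fin L → ℝ := fun e => if e.val < K then (if Fo e then missCost K p e else 0) else 0
  have hobs0 : ∀ e, 0 ≤ obsProb p A e := fun e =>
    Finset.sum_nonneg fun k _ => by split_ifs; exacts [hpre0 k, le_rfl]
  have hfG : ∀ e, 0 ≤ fG e := fun e => by
    simp only [fG]; split_ifs; exacts [mul_nonneg (hobs0 e) (hG e), le_rfl]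
  have hfs : ∀ e, 0 ≤ fs e := fun e => by simp only [fs]; split_ifs <;> simp
  have hfo : ∀ e, 0 ≤ fo e := fun e => by
    simp only [fo]; split_ifs; exacts [missCost_nonneg hp0 hp1 e, le_rfl, le_rfl]
  have hterm : ∀ k, (p (b k) - p (A k)) * pre k * post k ≤ fG (A k) + fs (A k) + fo (b k) := by
    intro k
    rcases lt_or_ge (A k).val K with hk | hk
    · rw [hbA k hk]
      have := hfo (A k)
      have := hfs (A k)
      have := hfG (A k)
      simp only [sub_self, zero_mul]
      linarith
    · have hle : b k ≤ A k := by rw [Fin.le_def]; exact ((hb k).trans_le hk).le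
      have hgap0 : 0 ≤ p (b k) - p (A k) := by linarith [hp hle]
      have hpp0 : 0 ≤ pre k * post k := mul_nonneg (hpre0 k) (hpost0 k)
      have hpp1 : pre k * post k ≤ 1 := mul_le_one₀ (hpre1 k) (hpost0 k) (hpost1 k)
      have h1 := hfo (b k)
      have h2 := hfs (A k)
      have h3 := hfG (A k)
      rw [mul_assoc]
      by_cases hFs : Fs (A k)
      · have : fs (A k) = 1 := by simp [fs, hk, hFs]
        have h4 : (p (b k) - p (A k)) * (pre k * post k) ≤ 1 :=
          mul_le_one₀ (by linarith [hp1 (b k), hp0 (A k)]) hpp0 hpp1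
        linarith
      by_cases hFo : Fo (b k)
      · have : fo (b k) = missCost K p (b k) := by simp [fo, hb k, hFo]
        have h4 : (p (b k) - p (A k)) * (pre k * post k) ≤ p (b k) * (pre k * post k) :=
          mul_le_mul_of_nonneg_right (by linarith [hp0 (A k)]) hpp0
        linarith [hmiss k hk]
      · have h4 := hgood (A k) (b k) hk (hb k) ⟨k, rfl⟩ (hbA' k hk) hFs hFo
        have h5 : fG (A k) = pre k * G (A k) := by simp [fG, hk, obsProb_apply, hpre]
        have h6 : (p (b k) - p (A k)) * (pre k * post k) ≤ G (A k) * pre k :=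
          mul_le_mul h4 (mul_le_of_le_one_right (hpre0 k) (hpost1 k)) hpp0 (hG _)
        linarith
  rw [hdecomp, Finset.sum_filter, Finset.sum_filter, Finset.sum_filter]
  calc _ ≤ ∑ k, (fG (A k) + fs (A k) + fo (b k)) := Finset.sum_le_sum fun k _ => hterm k
    _ = ∑ k, fG (A k) + ∑ k, fs (A k) + ∑ k, fo (b k) := by
        rw [Finset.sum_add_distrib, Finset.sum_add_distrib]
    _ ≤ ∑ e, fG e + ∑ e, fs e + ∑ e, fo e :=
        add_le_add (add_le_add (sum_embedding_le_sum hfG A) (sum_embedding_le_sum hfs A))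
          (sum_embedding_le_sum hfo b)

end Regret

/-! ### Measurability of the algorithm -/

section Measurability

variable {Ω : Type*} [MeasurableSpace Ω] {L K : ℕ}

/-- Observation of `e` depends only on the items in front of it. Leaving out `V e` later makes the
event independent of the feedback of `e`. -/
lemma measurableSet_observed (A : Fin K ↪ Fin L) (e : Fin L) {V : Fin L → Ω → ℝ}
    (hV : ∀ e' ≠ e, Measurable (V e')) :
    MeasurableSet {ω | Observed A (fun e' => V e' ω) e} := by
  by_cases he : e ∈ Set.range A
  · obtain ⟨k, rfl⟩ := he
    simp only [observed_apply_iff, Set.ofPred_forall]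
    refine MeasurableSet.iInter fun i => MeasurableSet.iInter fun hi => ?_
    have hne : A i ≠ A k := fun h => hi.ne (A.injective h)
    exact (hV _ hne (measurableSet_singleton 1)).compl
  · convert MeasurableSet.empty using 1
    ext ω
    simpa using fun h => he (Observed.mem_range h)

variable {sel : ℕ → (Fin L → ℝ) → (Fin K ↪ Fin L)} {σ : ℝ} {W Z : ℕ → Fin L → Ω → ℝ}

lemma measurableSet_sel_ucb (hsel : IsTopKRule sel) {X : Ω → State L}
    (hc : ∀ e, Measurable fun ω => (X ω).count e) (hm : ∀ e, Measurable fun ω => (X ω).mean e)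
    (t : ℕ) (A : Fin K ↪ Fin L) : MeasurableSet {ω | sel t ((X ω).ucb σ t) = A} := by
  have hU : Measurable fun ω => (X ω).ucb σ t := by
    refine measurable_pi_lambda _ fun e => ?_
    have hc' : Measurable fun ω => ((X ω).count e : ℝ) := measurable_from_nat.comp (hc e)
    have := hm e
    unfold State.ucb
    fun_prop
  exact hU (hsel.measurable t A)

/-- Only rounds up to `t` enter and the `σ`-algebra is arbitrary, so this also gives measurability
with respect to `past W Z t`. -/
lemma measurable_state (hsel : IsTopKRule sel) (t : ℕ) (hW : ∀ s ≤ t, ∀ e, Measurable (W s e))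
    (hZ : ∀ s ≤ t, ∀ e, Measurable (Z s e)) :
    (∀ e, Measurable fun ω => (state sel σ (fun s e => W s e ω) (fun s e => Z s e ω) t).count e) ∧
    (∀ e, Measurable fun ω => (state sel σ (fun s e => W s e ω) (fun s e => Z s e ω) t).mean e) := by
  classical
  induction t with
  | zero => exact ⟨fun e => measurable_const, fun e => hW 0 le_rfl e⟩
  | succ t ih =>
    obtain ⟨hc, hm⟩ := ih (fun s hs => hW s (by omega)) (fun s hs => hZ s (by omega))
    have hA := measurableSet_sel_ucb (σ := σ) hsel hc hm (t + 1)
    have hobs : ∀ e, MeasurableSet {ω | Observed (sel (t + 1)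
        ((state sel σ (fun s e => W s e ω) (fun s e => Z s e ω) t).ucb σ (t + 1)))
          (fun e => W (t + 1) e ω) e} := by
      intro e
      have : {ω | Observed (sel (t + 1)
        ((state sel σ (fun s e => W s e ω) (fun s e => Z s e ω) t).ucb σ (t + 1)))
          (fun e => W (t + 1) e ω) e} = ⋃ A : Fin K ↪ Fin L, {ω | sel (t + 1)
        ((state sel σ (fun s e => W s e ω) (fun s e => Z s e ω) t).ucb σ (t + 1)) = A} ∩
          {ω | Observed A (fun e => W (t + 1) e ω) e} := by
        ext ω; simp
      rw [this]
      exact MeasurableSet.iUnion fun A => (hA A).inter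
        (measurableSet_observed A e fun e' _ => hW (t + 1) le_rfl e')
    refine ⟨fun e => ?_, fun e => ?_⟩
    · exact Measurable.ite (hobs e) ((hc e).add_const 1) (hc e)
    · have hc' : Measurable fun ω =>
          ((state sel σ (fun s e => W s e ω) (fun s e => Z s e ω) t).count e : ℝ) :=
        measurable_from_nat.comp (hc e)
      have hB : Measurable fun ω => if W (t + 1) e ω = 1 then (1 : ℝ) else 0 :=
        Measurable.ite (hW (t + 1) le_rfl e (measurableSet_singleton 1)) measurable_const
          measurable_const
      have hZ' := hZ (t + 1) le_rfl e
      have hm' := hm e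
      have h1 : Measurable fun ω =>
          (((state sel σ (fun s e => W s e ω) (fun s e => Z s e ω) t).count e : ℝ) *
            (state sel σ (fun s e => W s e ω) (fun s e => Z s e ω) t).mean e +
            (if W (t + 1) e ω = 1 then (1 : ℝ) else 0) + Z (t + 1) e ω) /
          (((state sel σ (fun s e => W s e ω) (fun s e => Z s e ω) t).count e : ℝ) + 1) :=
        (((hc'.mul hm').add hB).add hZ').div (hc'.add_const 1)
      have h2 := @Measurable.ite _ _ _ _ _ _ _ (fun _ => Classical.propDecidable _) (hobs e) h1 (hm e)
      convert h2 using 2 with ω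
      simp only [state, State.update]
      split_ifs with ho h3 h4 h4 <;> first | rfl | skip
      · exact absurd (ho.clicked_iff.1 h3) h4
      · exact absurd (ho.clicked_iff.2 h4) h3

lemma measurableSet_action (hsel : IsTopKRule sel) (t : ℕ)
    (hW : ∀ s ≤ t, ∀ e, Measurable (W s e)) (hZ : ∀ s ≤ t, ∀ e, Measurable (Z s e))
    (A : Fin K ↪ Fin L) :
    MeasurableSet {ω | action sel σ (fun s e => W s e ω) (fun s e => Z s e ω) (t + 1) = A} :=
  measurableSet_sel_ucb hsel (measurable_state hsel t hW hZ).1 (measurable_state hsel t hW hZ).2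
    (t + 1) A

end Measurability

/-! ### Pathwise properties of the counters and the means -/

section Path

variable {L K : ℕ} {sel : ℕ → (Fin L → ℝ) → (Fin K ↪ Fin L)} {σ : ℝ} {w z : ℕ → Fin L → ℝ}

lemma one_le_count (t : ℕ) (e : Fin L) : 1 ≤ (state sel σ w z t).count e := by
  induction t with
  | zero => exact le_rfl
  | succ t ih =>
    simp only [state, State.update]
    split_ifs <;> omega

lemma count_le (t : ℕ) (e : Fin L) : (state sel σ w z t).count e ≤ t + 1 := by
  induction t with
  | zero => exact le_rfl
  | succ t ih =>
    simp only [state, State.update]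
    split_ifs <;> omega

open Classical in
lemma count_succ (t : ℕ) (e : Fin L) :
    (state sel σ w z (t + 1)).count e = (state sel σ w z t).count e +
      if Observed (action sel σ w z (t + 1)) (w (t + 1)) e then 1 else 0 := by
  simp only [state, State.update, action, Nat.add_sub_cancel]
  split_ifs <;> rfl

open Classical in
-- The counter starts at `1` and grows by one at each observation, so successive observations meet
-- the values `1, 2, …` once each.
lemma sum_observed_eq (f : ℕ → ℝ) (n : ℕ) (e : Fin L) :
    ∑ t ∈ Finset.range n, (if Observed (action sel σ w z (t + 1)) (w (t + 1)) e then 1 else 0) *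
      f ((state sel σ w z t).count e) =
    ∑ s ∈ Finset.Ico 1 ((state sel σ w z n).count e), f s := by
  induction n with
  | zero => simp [state, State.init]
  | succ n ih =>
    rw [Finset.sum_range_succ, ih, count_succ]
    split_ifs
    · rw [Finset.sum_Ico_succ_top (one_le_count n e), one_mul]
    · simp

/-- Cumulative deviation of the noisy observations of `e` from the value `q`. -/
def deviation (s : State L) (q : ℝ) (e : Fin L) : ℝ := s.count e * (s.mean e - q)

open Classical in
-- Multiplying by the counter undoes the averaging and leaves an additive process.
lemma deviation_succ (q : ℝ) (t : ℕ) (e : Fin L) :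
    deviation (state sel σ w z (t + 1)) q e = deviation (state sel σ w z t) q e +
      if Observed (action sel σ w z (t + 1)) (w (t + 1)) e then
        (if w (t + 1) e = 1 then 1 else 0) - q + z (t + 1) e else 0 := by
  simp only [deviation, state, State.update, action, Nat.add_sub_cancel]
  by_cases ho : Observed (sel (t + 1) ((state sel σ w z t).ucb σ (t + 1))) (w (t + 1)) e
  · simp only [ho, if_true, ho.clicked_iff]
    have : ((state sel σ w z t).count e : ℝ) + 1 ≠ 0 := by positivity
    push_cast
    field_simp
    ring
  · simp only [ho, if_false, add_zero]

end Path

/-! ### Freezing the list of a round -/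

/-- This plays the role of conditioning on `m₁`: `a` has finitely many values, and on each event `a
= i` the integrand is a product of independent factors. -/
lemma integral_mul_freeze {Ω ι : Type*} {m₁ m₂ mΩ : MeasurableSpace Ω} {μ : Measure Ω}
    [Fintype ι] (h₁ : m₁ ≤ mΩ) (hind : Indep m₁ m₂ μ) {a : Ω → ι}
    (ha : ∀ i, MeasurableSet[m₁] {ω | a ω = i}) {Y : Ω → ℝ} (hY : Measurable[m₁] Y)
    (hYi : Integrable Y μ) {F : ι → Ω → ℝ} (hF : ∀ i, Measurable[m₂] (F i))
    (hFi : ∀ i, Integrable (F i) μ) :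
    Integrable (fun ω => Y ω * F (a ω) ω) μ ∧
      ∫ ω, Y ω * F (a ω) ω ∂μ = ∫ ω, Y ω * ∫ ω', F (a ω) ω' ∂μ ∂μ := by
  classical
  have hdec : ∀ H : ι → Ω → ℝ, (fun ω => Y ω * H (a ω) ω) =
      fun ω => ∑ i, Set.indicator {ω | a ω = i} Y ω * H i ω := by
    intro H
    ext ω
    simp [Set.indicator_apply]
  have hYA : ∀ i, Integrable (Set.indicator {ω | a ω = i} Y) μ := fun i =>
    hYi.indicator (h₁ _ (ha i))
  have hindep : ∀ i, IndepFun (Set.indicator {ω | a ω = i} Y) (F i) μ := fun i => by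
    rw [IndepFun_iff_Indep]
    refine indep_of_indep_of_le_left (indep_of_indep_of_le_right hind ?_) ?_
    · exact (hF i).comap_le
    · exact (hY.indicator (ha i)).comap_le
  have hint : ∀ i, Integrable (fun ω => Set.indicator {ω | a ω = i} Y ω * F i ω) μ := fun i =>
    (hindep i).integrable_mul (hYA i) (hFi i)
  constructor
  · rw [hdec F]
    exact integrable_finsetSum _ fun i _ => hint i
  · rw [hdec F, hdec fun i _ => ∫ ω', F i ω' ∂μ,
      integral_finsetSum _ fun i _ => hint i,
      integral_finsetSum _ fun i _ => (hYA i).mul_const _]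
    refine Finset.sum_congr rfl fun i _ => ?_
    rw [(hindep i).integral_fun_mul_eq_mul_integral (hYA i).1 (hFi i).1, integral_mul_const]

/-! ### The random weights and noises -/

section Model

/-- The `σ`-algebra generated by the random variables `X i` with `i ∈ S`. -/
abbrev generated {Ω ι : Type*} (X : ι → Ω → ℝ) (S : Set ι) : MeasurableSpace Ω :=
  ⨆ i ∈ S, MeasurableSpace.comap (X i) inferInstance

lemma measurable_generated {Ω ι : Type*} (X : ι → Ω → ℝ) {S : Set ι} {i : ι} (hi : i ∈ S) :
    Measurable[generated X S] (X i) :=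
  measurable_iff_comap_le.2 <| le_iSup₂_of_le
    (f := fun i (_ : i ∈ S) => MeasurableSpace.comap (X i) inferInstance) i hi le_rfl

/-- All weights and noises as one family. -/
abbrev source {Ω : Type*} {L : ℕ} (W Z : ℕ → Fin L → Ω → ℝ) :
    (ℕ × Fin L) ⊕ (ℕ × Fin L) → Ω → ℝ :=
  Sum.elim (fun p => W p.1 p.2) (fun p => Z p.1 p.2)

/-- The `σ`-algebra of the weights and noises of the rounds `0, …, t`. -/
abbrev past {Ω : Type*} {L : ℕ} (W Z : ℕ → Fin L → Ω → ℝ) (t : ℕ) : MeasurableSpace Ω :=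
  generated (source W Z) {i | Sum.elim (fun p => p.1) (fun p => p.1) i ≤ t}

/-- The `σ`-algebra of the weights and noises of round `t`. -/
abbrev present {Ω : Type*} {L : ℕ} (W Z : ℕ → Fin L → Ω → ℝ) (t : ℕ) : MeasurableSpace Ω :=
  generated (source W Z) {i | Sum.elim (fun p => p.1) (fun p => p.1) i = t}

section

variable {Ω : Type*} {L : ℕ} {W Z : ℕ → Fin L → Ω → ℝ} {s t : ℕ}

lemma measurable_weight_past (hs : s ≤ t) (e : Fin L) : Measurable[past W Z t] (W s e) :=
  measurable_generated (source W Z) (i := Sum.inl (s, e)) hs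

lemma measurable_noise_past (hs : s ≤ t) (e : Fin L) : Measurable[past W Z t] (Z s e) :=
  measurable_generated (source W Z) (i := Sum.inr (s, e)) hs

lemma measurable_weight_present (e : Fin L) : Measurable[present W Z t] (W t e) :=
  measurable_generated (source W Z) (i := Sum.inl (t, e)) rfl

lemma measurable_noise_present (e : Fin L) : Measurable[present W Z t] (Z t e) :=
  measurable_generated (source W Z) (i := Sum.inr (t, e)) rfl

end

variable {Ω : Type*} [mΩ : MeasurableSpace Ω] {L K : ℕ}

namespace IsModel

variable {μ : Measure Ω} {wbar : Fin L → unitInterval} {σ : ℝ} {W Z : ℕ → Fin L → Ω → ℝ}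

lemma measurable_source (h : IsModel μ wbar σ W Z) (i : (ℕ × Fin L) ⊕ (ℕ × Fin L)) :
    Measurable (source W Z i) := by
  rcases i with i | i
  · exact h.measurable_weight _ _
  · exact h.measurable_noise _ _

lemma past_le (h : IsModel μ wbar σ W Z) (t : ℕ) : past W Z t ≤ mΩ :=
  iSup₂_le fun i _ => (h.measurable_source i).comap_le

lemma present_le (h : IsModel μ wbar σ W Z) (t : ℕ) : present W Z t ≤ mΩ :=
  iSup₂_le fun i _ => (h.measurable_source i).comap_le

lemma indep_past_present (h : IsModel μ wbar σ W Z) (t : ℕ) :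
    Indep (past W Z t) (present W Z (t + 1)) μ := by
  refine indep_iSup_of_disjoint (fun i => (h.measurable_source i).comap_le) h.indep.iIndep ?_
  rw [Set.disjoint_left]
  intro i hi hi'
  simp only [Set.mem_ofPred_eq] at hi hi'
  omega

/-- The weights of a round other than that of `e` are independent of the weight and the noise
of `e`. -/
lemma indepFun_of_ne (h : IsModel μ wbar σ W Z) (t : ℕ) (e : Fin L) {f g : Ω → ℝ}
    (hf : Measurable[generated (source W Z) {i | ∃ e', e' ≠ e ∧ i = Sum.inl (t, e')}] f)
    (hg : Measurable[generated (source W Z) {Sum.inl (t, e), Sum.inr (t, e)}] g) :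
    IndepFun f g μ := by
  rw [IndepFun_iff_Indep]
  have key := indep_iSup_of_disjoint (fun i => (h.measurable_source i).comap_le) h.indep.iIndep
    (S := {i | ∃ e', e' ≠ e ∧ i = Sum.inl (t, e')}) (T := {Sum.inl (t, e), Sum.inr (t, e)})
    (by
      rw [Set.disjoint_left]
      rintro i ⟨e', he', rfl⟩ hi
      simp only [Set.mem_insert_iff, Sum.inl.injEq, Prod.mk.injEq, true_and,
        Set.mem_singleton_iff, reduceCtorEq, or_false] at hi
      exact he' hi)
  exact indep_of_indep_of_le_left (indep_of_indep_of_le_right key hg.comap_le) hf.comap_le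

lemma indepFun_weight_noise (h : IsModel μ wbar σ W Z) (t : ℕ) (e : Fin L) :
    IndepFun (W t e) (Z t e) μ :=
  h.indep.indepFun (i := Sum.inl (t, e)) (j := Sum.inr (t, e)) (by simp)

lemma integral_comp_weight (h : IsModel μ wbar σ W Z) (t : ℕ) (e : Fin L) {f : ℝ → ℝ}
    (hf : Measurable f) :
    ∫ ω, f (W t e ω) ∂μ = wbar e * f 1 + (1 - wbar e) * f 0 := by
  rw [← integral_map (h.measurable_weight t e).aemeasurable hf.aestronglyMeasurable,
    h.law_weight, integral_bernoulliMeasure]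
  simp

lemma ae_weight (h : IsModel μ wbar σ W Z) (t : ℕ) (e : Fin L) :
    ∀ᵐ ω ∂μ, W t e ω = 0 ∨ W t e ω = 1 := by
  have hs : MeasurableSet {x : ℝ | x = 0 ∨ x = 1} :=
    (measurableSet_singleton 0).union (measurableSet_singleton 1)
  refine ae_of_ae_map (h.measurable_weight t e).aemeasurable (p := fun x => x = 0 ∨ x = 1) ?_
  rw [h.law_weight, ae_iff, bernoulliMeasure_apply_of_notMem_of_notMem]
  · exact hs.compl
  · simp
  · simp

lemma integral_prod_weight (h : IsModel μ wbar σ W Z) (t : ℕ) (A : Fin K ↪ Fin L)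
    {f : Fin K → ℝ → ℝ} (hf : ∀ k, Measurable (f k)) :
    ∫ ω, ∏ k, f k (W t (A k) ω) ∂μ = ∏ k, (wbar (A k) * f k 1 + (1 - wbar (A k)) * f k 0) := by
  have hind : iIndepFun (fun k => W t (A k)) μ :=
    h.indep.precomp (g := fun k => Sum.inl (t, A k)) fun i j hij => by simpa using hij
  rw [hind.integral_fun_prod_comp (fun k => (h.measurable_weight t (A k)).aemeasurable)
    fun k => (hf k).aestronglyMeasurable]
  exact Finset.prod_congr rfl fun k _ => h.integral_comp_weight t (A k) (hf k)

lemma integral_prod_one_sub (h : IsModel μ wbar σ W Z) (t : ℕ) (A : Fin K ↪ Fin L) :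
    ∫ ω, ∏ k, (1 - W t (A k) ω) ∂μ = ∏ k, (1 - (wbar (A k) : ℝ)) := by
  rw [h.integral_prod_weight t A (f := fun _ x => 1 - x) fun k => by fun_prop]
  simp

open Classical in
lemma integral_observed (h : IsModel μ wbar σ W Z) [IsProbabilityMeasure μ] (t : ℕ)
    (A : Fin K ↪ Fin L) (e : Fin L) :
    ∫ ω, (if Observed A (fun e => W t e ω) e then (1 : ℝ) else 0) ∂μ =
      obsProb (fun e => (wbar e : ℝ)) A e := by
  by_cases he : e ∈ Set.range A
  · obtain ⟨k, rfl⟩ := he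
    have hf : ∀ i, Measurable fun x : ℝ => if i < k then (if x = 1 then (0 : ℝ) else 1) else 1 := by
      intro i
      by_cases hi : i < k
      · simp only [hi, if_true]
        exact Measurable.ite (measurableSet_singleton (1 : ℝ)) measurable_const measurable_const
      · simp [hi]
    have := h.integral_prod_weight t A hf
    rw [obsProb_apply, Finset.prod_filter]
    convert this using 1
    · congr 1
      ext ω
      rw [observed_apply_iff]
      by_cases hall : ∀ i < k, W t (A i) ω ≠ 1
      · rw [if_pos hall, Finset.prod_eq_one]
        intro i _
        by_cases hi : i < k
        · simp [hi, hall i hi]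
        · simp [hi]
      · rw [if_neg hall]
        push Not at hall
        obtain ⟨i, hi, hw⟩ := hall
        exact (Finset.prod_eq_zero (Finset.mem_univ i) (by simp [hi, hw])).symm
    · refine Finset.prod_congr rfl fun i _ => ?_
      by_cases hi : i < k <;> simp [hi]
  · rw [obsProb_of_notMem _ he]
    simp [show ∀ ω, ¬ Observed A (fun e => W t e ω) e from fun ω ho => he ho.mem_range]

end IsModel

end Model

/-! ### Concentration of the noisy means -/

section Concentration

variable {Ω : Type*} [mΩ : MeasurableSpace Ω] {L K : ℕ} {μ : Measure Ω}
  {wbar : Fin L → unitInterval} {σ : ℝ} {W Z : ℕ → Fin L → Ω → ℝ}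
  {sel : ℕ → (Fin L → ℝ) → (Fin K ↪ Fin L)}

namespace IsModel

lemma hasSubgaussianMGF_weight [IsProbabilityMeasure μ] (h : IsModel μ wbar σ W Z) (t : ℕ) (e : Fin L) :
    HasSubgaussianMGF (fun ω => W t e ω - wbar e) (1 / 4) μ := by
  have h1 : ∀ᵐ ω ∂μ, W t e ω ∈ Set.Icc (0 : ℝ) 1 := by
    filter_upwards [h.ae_weight t e] with ω hω
    rcases hω with hω | hω <;> simp [hω]
  have h2 := hasSubgaussianMGF_of_mem_Icc (h.measurable_weight t e).aemeasurable h1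
  have h3 : ∫ ω, W t e ω ∂μ = wbar e := by
    simpa using h.integral_comp_weight t e (f := fun x => x) measurable_id
  rw [h3] at h2
  convert h2 using 1
  ext
  norm_num

lemma hasSubgaussianMGF_noise (h : IsModel μ wbar σ W Z) (t : ℕ) (e : Fin L) :
    HasSubgaussianMGF (Z t e) (σ ^ 2).toNNReal μ where
  integrable_exp_mul x := by
    have := integrable_exp_mul_gaussianReal (μ := 0) (v := (σ ^ 2).toNNReal) x
    rw [← h.law_noise t e] at this
    exact this.comp_measurable (h.measurable_noise t e)
  mgf_le x := by
    rw [mgf_gaussianReal (h.law_noise t e)]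
    simp

lemma hasSubgaussianMGF_feedback [IsProbabilityMeasure μ] (h : IsModel μ wbar σ W Z) (t : ℕ) (e : Fin L) :
    HasSubgaussianMGF (fun ω => (if W t e ω = 1 then 1 else 0) - (wbar e : ℝ) + Z t e ω)
      (1 / 4 + (σ ^ 2).toNNReal) μ := by
  have h1 := (h.hasSubgaussianMGF_weight t e).add_of_indepFun (h.hasSubgaussianMGF_noise t e)
    ((h.indepFun_weight_noise t e).comp (φ := fun x => x - (wbar e : ℝ)) (ψ := fun x => x)
      (by fun_prop) measurable_id)
  refine h1.congr ?_
  filter_upwards [h.ae_weight t e] with ω hω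
  rcases hω with hω | hω <;> simp [hω]

open Classical in
-- One supermartingale step. The observation indicator `o` is independent of the exponential factor
-- `ξ`, so the integral is `1 - E o + E o * E ξ`, and `E ξ ≤ 1` by the sub-Gaussian bound: `1/4`
-- from the Bernoulli weight, `σ ^ 2` from the noise.
lemma integral_observed_exp_le [IsProbabilityMeasure μ] (h : IsModel μ wbar σ W Z) (t : ℕ) (A : Fin K ↪ Fin L)
    (e : Fin L) (x : ℝ) :
    Integrable (fun ω => if Observed A (fun e => W t e ω) e then
        Real.exp (x * ((if W t e ω = 1 then 1 else 0) - (wbar e : ℝ) + Z t e ω) -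
          (1 / 4 + σ ^ 2) * x ^ 2 / 2) else 1) μ ∧
    ∫ ω, (if Observed A (fun e => W t e ω) e then
        Real.exp (x * ((if W t e ω = 1 then 1 else 0) - (wbar e : ℝ) + Z t e ω) -
          (1 / 4 + σ ^ 2) * x ^ 2 / 2) else 1) ∂μ ≤ 1 := by
  set ξ : Ω → ℝ := fun ω => Real.exp (x * ((if W t e ω = 1 then 1 else 0) - (wbar e : ℝ) + Z t e ω) -
          (1 / 4 + σ ^ 2) * x ^ 2 / 2) with hξ
  set o : Ω → ℝ := Set.indicator {ω | Observed A (fun e => W t e ω) e} (fun _ => 1) with ho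
  have hsub := h.hasSubgaussianMGF_feedback t e
  have hξi : Integrable ξ μ := by
    simp only [hξ, Real.exp_sub]
    exact (hsub.integrable_exp_mul x).div_const _
  have hξ1 : ∫ ω, ξ ω ∂μ ≤ 1 := by
    simp only [hξ, Real.exp_sub]
    rw [integral_div, div_le_one (Real.exp_pos _)]
    have := hsub.mgf_le x
    rw [mgf] at this
    push_cast at this
    rwa [Real.coe_toNNReal _ (sq_nonneg σ)] at this
  have hobs : MeasurableSet[generated (source W Z) {i | ∃ e', e' ≠ e ∧ i = Sum.inl (t, e')}]
      {ω | Observed A (fun e => W t e ω) e} :=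
    @measurableSet_observed _ (generated (source W Z) {i | ∃ e', e' ≠ e ∧ i = Sum.inl (t, e')}) _ _
      A e (W t) fun e' he' => measurable_generated (source W Z) (i := Sum.inl (t, e'))
        ⟨e', he', rfl⟩
  have hobs' : MeasurableSet {ω | Observed A (fun e => W t e ω) e} :=
    measurableSet_observed A e fun e' _ => h.measurable_weight t e'
  have hind : IndepFun o ξ μ := by
    refine h.indepFun_of_ne t e (measurable_const.indicator hobs) ?_
    have hW : Measurable[generated (source W Z) {Sum.inl (t, e), Sum.inr (t, e)}] (W t e) :=
      measurable_generated (source W Z) (i := Sum.inl (t, e)) (by simp)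
    have hZ : Measurable[generated (source W Z) {Sum.inl (t, e), Sum.inr (t, e)}] (Z t e) :=
      measurable_generated (source W Z) (i := Sum.inr (t, e)) (by simp)
    have hB : Measurable[generated (source W Z) {Sum.inl (t, e), Sum.inr (t, e)}]
        fun ω => if W t e ω = 1 then (1 : ℝ) else 0 :=
      Measurable.ite (hW (measurableSet_singleton 1)) measurable_const measurable_const
    exact Real.measurable_exp.comp ((((hB.sub_const _).add hZ).const_mul x).sub_const _)
  have hoi : Integrable o μ := (integrable_const 1).indicator hobs'
  have hprod : Integrable (fun ω => o ω * ξ ω) μ := hind.integrable_mul hoi hξi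
  have heq : (fun ω => if Observed A (fun e => W t e ω) e then ξ ω else 1) =
      fun ω => 1 - o ω + o ω * ξ ω := by
    ext ω
    by_cases hω : Observed A (fun e => W t e ω) e <;> simp [ho, hω]
  have h1o : Integrable (fun ω => 1 - o ω) μ := (integrable_const 1).sub hoi
  change Integrable (fun ω => if Observed A (fun e => W t e ω) e then ξ ω else 1) μ ∧
    ∫ ω, (fun ω => if Observed A (fun e => W t e ω) e then ξ ω else 1) ω ∂μ ≤ 1
  rw [heq]
  refine ⟨h1o.add hprod, ?_⟩
  rw [integral_add h1o hprod, integral_sub (integrable_const 1) hoi,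
    hind.integral_fun_mul_eq_mul_integral hoi.1 hξi.1]
  have ho0 : 0 ≤ ∫ ω, o ω ∂μ := integral_nonneg fun ω => Set.indicator_nonneg (by simp) ω
  simp only [integral_const, probReal_univ, smul_eq_mul, mul_one]
  nlinarith

/-- The exponential process of the deviations of an item is a supermartingale. -/
lemma integral_exp_deviation_le [IsProbabilityMeasure μ] (h : IsModel μ wbar σ W Z) (hsel : IsTopKRule sel) (e : Fin L)
    (x : ℝ) (t : ℕ) :
    Integrable (fun ω => Real.exp
      (x * deviation (state sel σ (fun s e => W s e ω) (fun s e => Z s e ω) t) (wbar e) e -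
        (state sel σ (fun s e => W s e ω) (fun s e => Z s e ω) t).count e *
          ((1 / 4 + σ ^ 2) * x ^ 2 / 2))) μ ∧
    ∫ ω, Real.exp
      (x * deviation (state sel σ (fun s e => W s e ω) (fun s e => Z s e ω) t) (wbar e) e -
        (state sel σ (fun s e => W s e ω) (fun s e => Z s e ω) t).count e *
          ((1 / 4 + σ ^ 2) * x ^ 2 / 2)) ∂μ ≤ 1 := by
  classical
  induction t with
  | zero =>
    -- The initial sample carries no noise; its proxy `1/4` lies below the allowed `1/4 + σ ^ 2`.
    have hsub := h.hasSubgaussianMGF_weight 0 e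
    simp only [state, State.init, deviation, Nat.cast_one, one_mul, Real.exp_sub]
    refine ⟨(hsub.integrable_exp_mul x).div_const _, ?_⟩
    rw [integral_div, div_le_one (Real.exp_pos _)]
    refine (hsub.mgf_le x).trans (Real.exp_le_exp.2 ?_)
    push_cast
    nlinarith [mul_nonneg (sq_nonneg σ) (sq_nonneg x)]
  | succ t ih =>
    set Y : Ω → ℝ := fun ω => Real.exp
      (x * deviation (state sel σ (fun s e => W s e ω) (fun s e => Z s e ω) t) (wbar e) e -
        (state sel σ (fun s e => W s e ω) (fun s e => Z s e ω) t).count e *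
          ((1 / 4 + σ ^ 2) * x ^ 2 / 2)) with hYdef
    set F : (Fin K ↪ Fin L) → Ω → ℝ := fun A ω => if Observed A (fun e => W (t + 1) e ω) e then
        Real.exp (x * ((if W (t + 1) e ω = 1 then 1 else 0) - (wbar e : ℝ) + Z (t + 1) e ω) -
          (1 / 4 + σ ^ 2) * x ^ 2 / 2) else 1 with hFdef
    set a : Ω → (Fin K ↪ Fin L) :=
      fun ω => action sel σ (fun s e => W s e ω) (fun s e => Z s e ω) (t + 1) with hadef
    have hstate := @measurable_state _ (past W Z t) _ _ sel σ W Z hsel t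
      (fun s hs => measurable_weight_past hs) (fun s hs => measurable_noise_past hs)
    have ha : ∀ A, MeasurableSet[past W Z t] {ω | a ω = A} :=
      @measurableSet_action _ (past W Z t) _ _ sel σ W Z hsel t
      (fun s hs => measurable_weight_past hs) (fun s hs => measurable_noise_past hs)
    have hY : Measurable[past W Z t] Y := by
      have hc : Measurable[past W Z t] fun ω =>
          ((state sel σ (fun s e => W s e ω) (fun s e => Z s e ω) t).count e : ℝ) :=
        measurable_from_nat.comp (hstate.1 e)
      exact Real.measurable_exp.comp
        (((hc.mul ((hstate.2 e).sub_const _)).const_mul x).sub (hc.mul_const _))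
    have hF : ∀ A, Measurable[present W Z (t + 1)] (F A) := by
      intro A
      have hobs : MeasurableSet[present W Z (t + 1)]
          {ω | Observed A (fun e => W (t + 1) e ω) e} :=
        @measurableSet_observed _ (present W Z (t + 1)) _ _ A e (W (t + 1))
          fun e' _ => measurable_weight_present e'
      have hB : Measurable[present W Z (t + 1)]
          fun ω => if W (t + 1) e ω = 1 then (1 : ℝ) else 0 :=
        Measurable.ite ((measurable_weight_present e) (measurableSet_singleton 1))
          measurable_const measurable_const
      exact Measurable.ite hobs (Real.measurable_exp.comp
        ((((hB.sub_const _).add (measurable_noise_present e)).const_mul x).sub_const _))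
        measurable_const
    have hFi := fun A : Fin K ↪ Fin L => (h.integral_observed_exp_le (t + 1) A e x)
    have key := integral_mul_freeze (h.past_le t) (h.indep_past_present t) ha hY ih.1 hF
      fun A => (hFi A).1
    have heq : (fun ω => Real.exp
      (x * deviation (state sel σ (fun s e => W s e ω) (fun s e => Z s e ω) (t + 1)) (wbar e) e -
        (state sel σ (fun s e => W s e ω) (fun s e => Z s e ω) (t + 1)).count e *
          ((1 / 4 + σ ^ 2) * x ^ 2 / 2))) = fun ω => Y ω * F (a ω) ω := by
      ext ω
      rw [deviation_succ, count_succ]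
      simp only [hYdef, hFdef, hadef]
      split_ifs with ho
      · rw [← Real.exp_add]
        congr 1
        push_cast
        ring
      · rw [← Real.exp_add]
        congr 1
        push_cast
        ring
      · simp
    rw [heq]
    refine ⟨key.1, key.2.trans_le ((integral_mono_of_nonneg ?_ ih.1 ?_).trans ih.2)⟩
    · refine Filter.Eventually.of_forall fun ω => mul_nonneg (Real.exp_nonneg _)
        (integral_nonneg fun ω' => ?_)
      simp only [hFdef, Pi.zero_apply]
      split_ifs <;> positivity
    · exact Filter.Eventually.of_forall fun ω =>
        mul_le_of_le_one_right (Real.exp_nonneg _) (hFi _).2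

end IsModel

/-- Half the width of the confidence interval at round `t` after `s` observations. -/
def width (σ : ℝ) (t s : ℕ) : ℝ :=
  √(1.5 * Real.log t / s) + σ * √(2 * Real.log (2 * (t : ℝ) ^ 3) / s)

lemma width_pos {σ : ℝ} (hσ : 0 < σ) {t s : ℕ} (ht : 1 ≤ t) (hs : 1 ≤ s) : 0 < width σ t s := by
  have hs' : (0 : ℝ) < s := by exact_mod_cast hs
  have ht' : (1 : ℝ) ≤ t := by exact_mod_cast ht
  have : 0 < Real.log (2 * (t : ℝ) ^ 3) := Real.log_pos (by nlinarith [one_le_pow₀ ht' (n := 3)])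
  unfold width
  have : 0 < √(2 * Real.log (2 * (t : ℝ) ^ 3) / s) := Real.sqrt_pos.2 (by positivity)
  positivity

/-- The two parts of the width match the two variances: `1.5 = 6 * (1/4)`, and `2 log (2t³) ≥ 6 log
t`. The cross term is nonnegative. -/
lemma le_mul_width_sq {σ : ℝ} (hσ : 0 < σ) {t s : ℕ} (ht : 1 ≤ t) (hs : 1 ≤ s) :
    6 * (1 / 4 + σ ^ 2) * Real.log t ≤ s * width σ t s ^ 2 := by
  have hs' : (0 : ℝ) < s := by exact_mod_cast hs
  have ht' : (1 : ℝ) ≤ t := by exact_mod_cast ht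
  have hl : 0 ≤ Real.log t := Real.log_nonneg ht'
  have h2 : 3 * Real.log t ≤ Real.log (2 * (t : ℝ) ^ 3) := by
    rw [Real.log_mul (by norm_num) (by positivity), Real.log_pow]
    have := Real.log_nonneg (show (1 : ℝ) ≤ 2 by norm_num)
    push_cast
    linarith
  have h3 : √(1.5 * Real.log t / s) ^ 2 * s = 1.5 * Real.log t := by
    rw [Real.sq_sqrt (by positivity)]; field_simp
  have h4 : √(2 * Real.log (2 * (t : ℝ) ^ 3) / s) ^ 2 * s = 2 * Real.log (2 * (t : ℝ) ^ 3) := by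
    rw [Real.sq_sqrt (div_nonneg (by linarith) hs'.le)]; field_simp
  unfold width
  set a := √(1.5 * Real.log t / s)
  set b := √(2 * Real.log (2 * (t : ℝ) ^ 3) / s)
  have h5 : s * (a + σ * b) ^ 2 = a ^ 2 * s + σ ^ 2 * (b ^ 2 * s) + 2 * (s * a * (σ * b)) := by ring
  have h6 : 0 ≤ s * a * (σ * b) := by positivity
  rw [h5, h3, h4]
  nlinarith [mul_le_mul_of_nonneg_left h2 (sq_nonneg σ)]

/-- A one-sided confidence bound (upper for `c = 1`, lower for `c = -1`) fails at round `t + 1`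
with probability at most `(t + 1)⁻²`. -/
lemma IsModel.measureReal_fail_le [IsProbabilityMeasure μ] (h : IsModel μ wbar σ W Z) (hσ : 0 < σ)
    (hsel : IsTopKRule sel) (e : Fin L) (t : ℕ) {c : ℝ} (hc : c ^ 2 = 1) :
    μ.real {ω | width σ (t + 1)
        ((state sel σ (fun s e => W s e ω) (fun s e => Z s e ω) t).count e) <
      c * ((state sel σ (fun s e => W s e ω) (fun s e => Z s e ω) t).mean e - wbar e)} ≤
      1 / ((t + 1 : ℕ) : ℝ) ^ 2 := by
  set v : ℝ := 1 / 4 + σ ^ 2 with hv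
  have hv0 : 0 < v := by positivity
  set τ : ℝ := ((t + 1 : ℕ) : ℝ) with hτ
  have hτ0 : 0 < τ := by positivity
  -- The optimal Chernoff parameter for a deviation of one width at counter value `s`. The counter
  -- is random, hence a union over its `t + 1` possible values, which turns `τ⁻³` into `τ⁻²`.
  set x : ℕ → ℝ := fun s => c * width σ (t + 1) s / v with hx
  have hsub : {ω | width σ (t + 1)
        ((state sel σ (fun s e => W s e ω) (fun s e => Z s e ω) t).count e) <
      c * ((state sel σ (fun s e => W s e ω) (fun s e => Z s e ω) t).mean e - wbar e)} ⊆
      ⋃ s ∈ Finset.Icc 1 (t + 1), {ω | τ ^ 3 ≤ Real.exp (x s *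
        deviation (state sel σ (fun s e => W s e ω) (fun s e => Z s e ω) t) (wbar e) e -
        (state sel σ (fun s e => W s e ω) (fun s e => Z s e ω) t).count e *
          (v * x s ^ 2 / 2))} := by
    intro ω hω
    simp only [Set.mem_ofPred_eq] at hω
    simp only [Set.mem_iUnion, Set.mem_ofPred_eq, deviation]
    refine ⟨(state sel σ (fun s e => W s e ω) (fun s e => Z s e ω) t).count e,
      Finset.mem_Icc.2 ⟨one_le_count t e, count_le t e⟩, ?_⟩
    have hs1 := one_le_count (sel := sel) (σ := σ) (w := fun s e => W s e ω)
      (z := fun s e => Z s e ω) t e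
    set s := (state sel σ (fun s e => W s e ω) (fun s e => Z s e ω) t).count e
    set y := (state sel σ (fun s e => W s e ω) (fun s e => Z s e ω) t).mean e
    have hs' : (0 : ℝ) < s := by exact_mod_cast hs1
    have hw0 := width_pos hσ (t := t + 1) (by omega) hs1
    have hw := le_mul_width_sq hσ (t := t + 1) (by omega) hs1
    rw [← hv, ← hτ] at hw
    simp only [hx]
    set a := width σ (t + 1) s
    rw [← Real.log_le_iff_le_exp (by positivity), Real.log_pow]
    have h1 : c * a / v * (s * (y - wbar e)) - s * (v * (c * a / v) ^ 2 / 2) =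
        s * a * (c * (y - wbar e)) / v - c ^ 2 * (s * a ^ 2) / (2 * v) := by
      field_simp
    rw [h1, hc]
    have h2 : s * a * a / v ≤ s * a * (c * (y - wbar e)) / v := by gcongr
    have h3 : s * a * a / v - 1 * (s * a ^ 2) / (2 * v) = s * a ^ 2 / (2 * v) := by
      field_simp; ring
    have h4 : 3 * Real.log τ ≤ s * a ^ 2 / (2 * v) := by
      rw [le_div_iff₀ (by positivity)]
      nlinarith
    push_cast
    linarith
  refine (measureReal_mono hsub (measure_ne_top _ _)).trans
    ((measureReal_biUnion_finset_le _ _).trans ?_)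
  have hP : ∀ s ∈ Finset.Icc 1 (t + 1), μ.real {ω | τ ^ 3 ≤ Real.exp (x s *
        deviation (state sel σ (fun s e => W s e ω) (fun s e => Z s e ω) t) (wbar e) e -
        (state sel σ (fun s e => W s e ω) (fun s e => Z s e ω) t).count e *
          (v * x s ^ 2 / 2))} ≤ 1 / τ ^ 3 := by
    intro s _
    obtain ⟨hi, hle⟩ := h.integral_exp_deviation_le hsel e (x s) t
    have := mul_meas_ge_le_integral_of_nonneg
      (Filter.Eventually.of_forall fun ω => Real.exp_nonneg _) hi (τ ^ 3)
    rw [le_div_iff₀ (by positivity), mul_comm]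
    exact this.trans hle
  refine (Finset.sum_le_sum hP).trans (le_of_eq ?_)
  simp only [Finset.sum_const, Nat.card_Icc, nsmul_eq_mul, Nat.add_sub_cancel, ← hτ]
  field_simp

end Concentration

/-! ### Regret of one round -/

section Run

variable {Ω : Type*} {L K : ℕ} {σ : ℝ} {W Z : ℕ → Fin L → Ω → ℝ}
  {sel : ℕ → (Fin L → ℝ) → (Fin K ↪ Fin L)}

/-- The state at the end of round `t` as a random variable. -/
abbrev run (sel : ℕ → (Fin L → ℝ) → (Fin K ↪ Fin L)) (σ : ℝ) (W Z : ℕ → Fin L → Ω → ℝ) (t : ℕ)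
    (ω : Ω) : State L :=
  state sel σ (fun s e => W s e ω) (fun s e => Z s e ω) t

/-- The list of round `t` as a random variable. -/
abbrev play (sel : ℕ → (Fin L → ℝ) → (Fin K ↪ Fin L)) (σ : ℝ) (W Z : ℕ → Fin L → Ω → ℝ) (t : ℕ)
    (ω : Ω) : Fin K ↪ Fin L :=
  action sel σ (fun s e => W s e ω) (fun s e => Z s e ω) t

lemma cumulativeRegret_eq_sum_range (Astar : Fin K ↪ Fin L) (T : ℕ) (ω : Ω) :
    cumulativeRegret sel σ W Z Astar T ω = ∑ t ∈ Finset.range T,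
      (reward Astar (fun e => W (t + 1) e ω) -
        reward (play sel σ W Z (t + 1) ω) (fun e => W (t + 1) e ω)) := by
  unfold cumulativeRegret
  rw [Finset.range_eq_Ico, Finset.sum_Ico_add' (fun t => reward Astar (fun e => W t e ω) -
        reward (play sel σ W Z t ω) (fun e => W t e ω)) 0 T 1]
  rfl

end Run

section Round

variable {Ω : Type*} [mΩ : MeasurableSpace Ω] {L K : ℕ} {μ : Measure Ω}
  {wbar : Fin L → unitInterval} {σ : ℝ} {W Z : ℕ → Fin L → Ω → ℝ}
  {sel : ℕ → (Fin L → ℝ) → (Fin K ↪ Fin L)}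

namespace IsModel

/-- The list of round `t + 1` can be frozen when the weights of that round are averaged. -/
lemma integral_mul_play (h : IsModel μ wbar σ W Z) (hsel : IsTopKRule sel) (t : ℕ) {Y : Ω → ℝ}
    (hY : Measurable[past W Z t] Y) (hYi : Integrable Y μ) {F : (Fin K ↪ Fin L) → Ω → ℝ}
    (hF : ∀ A, Measurable[present W Z (t + 1)] (F A)) (hFi : ∀ A, Integrable (F A) μ) :
    Integrable (fun ω => Y ω * F (play sel σ W Z (t + 1) ω) ω) μ ∧
      ∫ ω, Y ω * F (play sel σ W Z (t + 1) ω) ω ∂μ =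
        ∫ ω, Y ω * ∫ ω', F (play sel σ W Z (t + 1) ω) ω' ∂μ ∂μ :=
  integral_mul_freeze (h.past_le t) (h.indep_past_present t)
    (@measurableSet_action _ (past W Z t) _ _ sel σ W Z hsel t
      (fun _ hs => measurable_weight_past hs) (fun _ hs => measurable_noise_past hs)) hY hYi hF hFi

lemma integrable_play [IsProbabilityMeasure μ] (h : IsModel μ wbar σ W Z) (hsel : IsTopKRule sel) (t : ℕ)
    (f : (Fin K ↪ Fin L) → ℝ) :
    Integrable (fun ω => f (play sel σ W Z (t + 1) ω)) μ := by
  simpa using (h.integral_mul_play hsel t (Y := fun _ => 1) measurable_const (integrable_const 1)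
    (F := fun A _ => f A) (fun _ => measurable_const) fun _ => integrable_const _).1

lemma integrable_prod_one_sub [IsProbabilityMeasure μ] (h : IsModel μ wbar σ W Z) (t : ℕ) (A : Fin K ↪ Fin L) :
    Integrable (fun ω => ∏ k, (1 - W t (A k) ω)) μ := by
  have hm : Measurable fun ω => ∏ k, (1 - W t (A k) ω) :=
    Finset.measurable_fun_prod _ fun k _ => (h.measurable_weight t (A k)).const_sub 1
  refine Integrable.of_bound hm.aestronglyMeasurable 1 ?_
  have : ∀ᵐ ω ∂μ, ∀ k, W t (A k) ω = 0 ∨ W t (A k) ω = 1 :=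
    ae_all_iff.2 fun k => h.ae_weight t (A k)
  filter_upwards [this] with ω hω
  rw [norm_prod]
  refine Finset.prod_le_one (fun k _ => norm_nonneg _) fun k _ => ?_
  rcases hω k with hk | hk <;> simp [hk]

lemma integrable_reward [IsProbabilityMeasure μ] (h : IsModel μ wbar σ W Z) (t : ℕ) (A : Fin K ↪ Fin L) :
    Integrable (fun ω => reward A fun e => W t e ω) μ :=
  (integrable_const 1).sub (h.integrable_prod_one_sub t A)

lemma integral_reward [IsProbabilityMeasure μ] (h : IsModel μ wbar σ W Z) (t : ℕ) (A : Fin K ↪ Fin L) :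
    ∫ ω, reward A (fun e => W t e ω) ∂μ = reward A fun e => (wbar e : ℝ) := by
  unfold reward
  rw [integral_sub (integrable_const 1) (h.integrable_prod_one_sub t A), h.integral_prod_one_sub]
  simp

/-- Freezing the list replaces the weights by their means, and no list beats the first `K` items. -/
lemma integral_roundRegret_le [IsProbabilityMeasure μ] (h : IsModel μ wbar σ W Z) (hsel : IsTopKRule sel)
    (hKL : K ≤ L) (hw : Antitone wbar) (Astar : Fin K ↪ Fin L) (t : ℕ) :
    Integrable (fun ω => reward Astar (fun e => W (t + 1) e ω) -
      reward (play sel σ W Z (t + 1) ω) (fun e => W (t + 1) e ω)) μ ∧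
    ∫ ω, (reward Astar (fun e => W (t + 1) e ω) -
      reward (play sel σ W Z (t + 1) ω) (fun e => W (t + 1) e ω)) ∂μ ≤
      ∫ ω, listRegret (fun e => (wbar e : ℝ)) (play sel σ W Z (t + 1) ω) ∂μ := by
  have hm : ∀ A : Fin K ↪ Fin L, Measurable[present W Z (t + 1)]
      fun ω => reward A fun e => W (t + 1) e ω := fun A =>
    (Finset.measurable_fun_prod _ fun k _ =>
      (measurable_weight_present (A k)).const_sub 1).const_sub 1
  obtain ⟨hi, heq⟩ := h.integral_mul_play hsel t (Y := fun _ => 1) measurable_const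
    (integrable_const 1) (F := fun A ω => reward A fun e => W (t + 1) e ω) hm
    fun A => h.integrable_reward (t + 1) A
  simp only [one_mul, h.integral_reward] at hi heq
  refine ⟨(h.integrable_reward _ _).sub hi, ?_⟩
  rw [integral_sub (h.integrable_reward _ _) hi, heq, h.integral_reward]
  have hi' := h.integrable_play hsel t fun A => reward A fun e => (wbar e : ℝ)
  have hle : ∫ ω, (reward Astar (fun e => (wbar e : ℝ)) -
      reward (play sel σ W Z (t + 1) ω) fun e => (wbar e : ℝ)) ∂μ ≤
      ∫ ω, listRegret (fun e => (wbar e : ℝ)) (play sel σ W Z (t + 1) ω) ∂μ := by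
    refine integral_mono ((integrable_const _).sub hi') (h.integrable_play hsel t _) fun ω => ?_
    have := prod_filter_lt_le_prod hKL (p := fun e => (wbar e : ℝ)) (fun a b hab => hw hab)
      (fun e => (wbar e).2.2) Astar
    simp only [reward, listRegret]
    linarith
  rw [integral_sub (integrable_const _) hi'] at hle
  simpa using hle

open Classical in
-- The counter is known before the round, so under the integral the observation probability may
-- become the indicator, which `sum_observed_eq` can sum over rounds.
lemma integral_obsProb_mul [IsProbabilityMeasure μ] (h : IsModel μ wbar σ W Z) (hsel : IsTopKRule sel) (t : ℕ)
    (e : Fin L) {f : ℕ → ℝ} (hf0 : ∀ s, 0 ≤ f s) (hf1 : ∀ s, f s ≤ 1) :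
    Integrable (fun ω => obsProb (fun e => (wbar e : ℝ)) (play sel σ W Z (t + 1) ω) e *
      f ((run sel σ W Z t ω).count e)) μ ∧
    Integrable (fun ω => (if Observed (play sel σ W Z (t + 1) ω) (fun e => W (t + 1) e ω) e
      then 1 else 0) * f ((run sel σ W Z t ω).count e)) μ ∧
    ∫ ω, obsProb (fun e => (wbar e : ℝ)) (play sel σ W Z (t + 1) ω) e *
      f ((run sel σ W Z t ω).count e) ∂μ =
    ∫ ω, (if Observed (play sel σ W Z (t + 1) ω) (fun e => W (t + 1) e ω) e
      then 1 else 0) * f ((run sel σ W Z t ω).count e) ∂μ := by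
  have hstate := @measurable_state _ (past W Z t) _ _ sel σ W Z hsel t
    (fun s hs => measurable_weight_past hs) (fun s hs => measurable_noise_past hs)
  have hY : Measurable[past W Z t] fun ω => f ((run sel σ W Z t ω).count e) :=
    measurable_from_nat.comp (hstate.1 e)
  have hYi : Integrable (fun ω => f ((run sel σ W Z t ω).count e)) μ :=
    Integrable.of_bound (hY.mono (h.past_le t) le_rfl).aestronglyMeasurable 1 <|
      Filter.Eventually.of_forall fun ω => by
        rw [Real.norm_eq_abs, abs_of_nonneg (hf0 _)]; exact hf1 _
  set F : (Fin K ↪ Fin L) → Ω → ℝ :=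
    fun A ω => if Observed A (fun e => W (t + 1) e ω) e then 1 else 0
  have hF : ∀ A, Measurable[present W Z (t + 1)] (F A) := fun A =>
    Measurable.ite (@measurableSet_observed _ (present W Z (t + 1)) _ _ A e (W (t + 1))
      fun e' _ => measurable_weight_present e') measurable_const measurable_const
  have hFi : ∀ A, Integrable (F A) μ := fun A =>
    Integrable.of_bound ((hF A).mono (h.present_le _) le_rfl).aestronglyMeasurable 1 <|
      Filter.Eventually.of_forall fun ω => by
        simp only [F]; split_ifs <;> simp
  obtain ⟨h1, h2⟩ := h.integral_mul_play hsel t hY hYi hF hFi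
  obtain ⟨h3, -⟩ := h.integral_mul_play hsel t hY hYi
    (F := fun A _ => obsProb (fun e => (wbar e : ℝ)) A e) (fun _ => measurable_const)
    fun _ => integrable_const _
  have hFint : ∀ A, ∫ ω, F A ω ∂μ = obsProb (fun e => (wbar e : ℝ)) A e := fun A =>
    h.integral_observed (t + 1) A e
  simp only [hFint] at h2
  simp only [mul_comm _ (f _)]
  exact ⟨h3, h1, h2.symm⟩

end IsModel

lemma cast_card_filter_ge (hKL : K ≤ L) :
    ((Finset.univ.filter fun e : Fin L => K ≤ e.val).card : ℝ) = L - K := by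
  have h1 : (Finset.univ.filter fun e : Fin L => e.val < K).card = K := by
    simpa [hKL] using Fin.card_filter_val_lt (n := L) (m := K)
  have h2 : (Finset.univ.filter fun e : Fin L => K ≤ e.val) =
      Finset.univ \ Finset.univ.filter fun e : Fin L => e.val < K := by
    ext e
    simp
  rw [h2, Finset.card_sdiff_of_subset (Finset.subset_univ _), h1, Finset.card_univ,
    Fintype.card_fin, Nat.cast_sub hKL]

/-- For `t ≥ 2` the factor `2` in `log (2t³)` is absorbed into `4 log T`, whence `√8`. -/
lemma two_mul_width_le {σ : ℝ} (hσ : 0 < σ) {t s T : ℕ} (ht : 2 ≤ t) (htT : t ≤ T)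
    (hs : 1 ≤ s) :
    2 * width σ t s ≤ √((2 * √1.5 + 2 * √8 * σ) ^ 2 * Real.log T / s) := by
  have hs' : (0 : ℝ) < s := by exact_mod_cast hs
  have ht' : (2 : ℝ) ≤ t := by exact_mod_cast ht
  have htT' : (t : ℝ) ≤ T := by exact_mod_cast htT
  have hl : Real.log t ≤ Real.log T := Real.log_le_log (by linarith) htT'
  have hl0 : 0 ≤ Real.log t := Real.log_nonneg (by linarith)
  have h2 : Real.log (2 * (t : ℝ) ^ 3) ≤ 4 * Real.log T := by
    rw [Real.log_mul (by norm_num) (by positivity), Real.log_pow]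
    have := Real.log_le_log (by norm_num) ht'
    push_cast
    linarith
  have h3 : √(1.5 * Real.log t / s) ≤ √1.5 * √(Real.log T / s) := by
    rw [← Real.sqrt_mul (by norm_num)]
    apply Real.sqrt_le_sqrt
    rw [mul_div_assoc]
    gcongr
  have h4 : √(2 * Real.log (2 * (t : ℝ) ^ 3) / s) ≤ √8 * √(Real.log T / s) := by
    rw [← Real.sqrt_mul (by norm_num)]
    apply Real.sqrt_le_sqrt
    rw [← mul_div_assoc]
    exact div_le_div_of_nonneg_right (by linarith) hs'.le
  rw [mul_div_assoc, Real.sqrt_mul (by positivity), Real.sqrt_sq (by positivity)]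
  unfold width
  nlinarith [mul_le_mul_of_nonneg_left h4 hσ.le]

lemma ucb_eq_mean_add_width (σ : ℝ) (t : ℕ) (s : State L) (e : Fin L) :
    s.ucb σ t e = s.mean e + width σ t (s.count e) := by
  simp only [State.ucb, width]
  ring

namespace IsModel

open Classical in
lemma integral_listRegret_le [IsProbabilityMeasure μ] (h : IsModel μ wbar σ W Z) (hσ : 0 < σ) (hsel : IsTopKRule sel)
    (hK : 1 ≤ K) (hKL : K ≤ L) (hw : Antitone wbar) {t T : ℕ} (ht : 1 ≤ t) (htT : t + 1 ≤ T) :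
    ∫ ω, listRegret (fun e => (wbar e : ℝ)) (play sel σ W Z (t + 1) ω) ∂μ ≤
      ∑ e : Fin L with K ≤ e.val,
        ∫ ω, (if Observed (play sel σ W Z (t + 1) ω) (fun e => W (t + 1) e ω) e then 1 else 0) *
          explorationCost ((2 * √1.5 + 2 * √8 * σ) ^ 2 * Real.log T) (gap wbar e (kth hK hKL))
            ((run sel σ W Z t ω).count e) ∂μ +
      (2 * (L - K : ℝ) + 1) / ((t + 1 : ℕ) : ℝ) ^ 2 := by
  set M := (2 * √1.5 + 2 * √8 * σ) ^ 2 * Real.log T with hM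
  set p : Fin L → ℝ := fun e => (wbar e : ℝ) with hp
  have hpa : Antitone p := fun a b hab => hw hab
  have hp0 : ∀ e, 0 ≤ p e := fun e => (wbar e).2.1
  have hp1 : ∀ e, p e ≤ 1 := fun e => (wbar e).2.2
  set G : Fin L → ℕ → ℝ := fun e => explorationCost M (gap wbar e (kth hK hKL)) with hG
  set bad : ℝ → Fin L → Set Ω := fun c e => {ω | width σ (t + 1) ((run sel σ W Z t ω).count e) <
      c * ((run sel σ W Z t ω).mean e - p e)} with hbad
  have hstate := measurable_state (σ := σ) hsel t (fun s _ => h.measurable_weight s)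
    (fun s _ => h.measurable_noise s)
  have hbadm : ∀ c e, MeasurableSet (bad c e) := fun c e =>
    measurableSet_lt ((measurable_from_nat (f := width σ (t + 1))).comp (hstate.1 e))
      (((hstate.2 e).sub_const _).const_mul c)
  have hbadP : ∀ c e, c ^ 2 = 1 → μ.real (bad c e) ≤ 1 / ((t + 1 : ℕ) : ℝ) ^ 2 := fun c e hc =>
    h.measureReal_fail_le hσ hsel e t hc
  have hpoint : ∀ ω, listRegret p (play sel σ W Z (t + 1) ω) ≤
      ∑ e : Fin L with K ≤ e.val, obsProb p (play sel σ W Z (t + 1) ω) e *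
        G e ((run sel σ W Z t ω).count e) +
      ∑ e : Fin L with K ≤ e.val, (bad 1 e).indicator (fun _ => (1 : ℝ)) ω +
      ∑ b : Fin L with b.val < K, (bad (-1) b).indicator (fun _ => missCost K p b) ω := by
    intro ω
    refine listRegret_le hKL hpa hp0 hp1 (play sel σ W Z (t + 1) ω) (fun e => ω ∈ bad 1 e)
      (fun b => ω ∈ bad (-1) b) (fun e => explorationCost_nonneg _ _ _) ?_
    rintro e b he hb ⟨k, rfl⟩ hbA hFs hFo
    set e := play sel σ W Z (t + 1) ω k
    simp only [hbad, Set.mem_ofPred_eq, not_lt] at hFs hFo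
    -- With both bounds in force, `p b ≤ U b ≤ U e ≤ p e + 2 * width`.
    have hU : (run sel σ W Z t ω).ucb σ (t + 1) b ≤ (run sel σ W Z t ω).ucb σ (t + 1) e :=
      hsel.top (t + 1) _ k b hbA
    rw [ucb_eq_mean_add_width, ucb_eq_mean_add_width] at hU
    have hwidth : 2 * width σ (t + 1) ((run sel σ W Z t ω).count e) ≤
        √(M / (run sel σ W Z t ω).count e) := two_mul_width_le hσ (t := t + 1) (by omega) htT
      (one_le_count (sel := sel) (σ := σ) (w := fun s e => W s e ω) (z := fun s e => Z s e ω) t e)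
    have hgap : gap wbar e (kth hK hKL) ≤ p b - p e := by
      have : b ≤ kth hK hKL := by
        rw [Fin.le_def]; simp only [kth]; omega
      have := hpa this
      simp only [gap, hp] at this ⊢
      linarith
    have hle : p b - p e ≤ √(M / (run sel σ W Z t ω).count e) := by linarith
    simp only [hG, explorationCost]
    rw [if_pos (hgap.trans hle)]
    exact le_min (by linarith [hp1 b, hp0 e]) hle
  have hobs := fun e => h.integral_obsProb_mul hsel t e (f := G e)
    (fun s => explorationCost_nonneg _ _ s) (fun s => explorationCost_le_one _ _ s)
  have hi1 : Integrable (fun ω => ∑ e : Fin L with K ≤ e.val,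
      obsProb p (play sel σ W Z (t + 1) ω) e * G e ((run sel σ W Z t ω).count e)) μ :=
    integrable_finsetSum _ fun e _ => (hobs e).1
  have hi2' : ∀ e, Integrable ((bad 1 e).indicator fun _ => (1 : ℝ)) μ := fun e =>
    (integrable_const _).indicator (hbadm 1 e)
  have hi2 : Integrable (fun ω => ∑ e : Fin L with K ≤ e.val,
      (bad 1 e).indicator (fun _ => (1 : ℝ)) ω) μ :=
    integrable_finsetSum _ fun e _ => hi2' e
  have hi3' : ∀ b, Integrable ((bad (-1) b).indicator fun _ => missCost K p b) μ := fun b =>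
    (integrable_const _).indicator (hbadm (-1) b)
  have hi3 : Integrable (fun ω => ∑ b : Fin L with b.val < K,
      (bad (-1) b).indicator (fun _ => missCost K p b) ω) μ :=
    integrable_finsetSum _ fun b _ => hi3' b
  have hi12 : Integrable (fun ω => ∑ e : Fin L with K ≤ e.val,
      obsProb p (play sel σ W Z (t + 1) ω) e * G e ((run sel σ W Z t ω).count e) +
      ∑ e : Fin L with K ≤ e.val, (bad 1 e).indicator (fun _ => (1 : ℝ)) ω) μ := hi1.add hi2
  refine (integral_mono (h.integrable_play hsel t _) (hi12.add hi3) hpoint).trans ?_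
  have hsum : ∫ ω, (∑ e : Fin L with K ≤ e.val, obsProb p (play sel σ W Z (t + 1) ω) e *
        G e ((run sel σ W Z t ω).count e) +
      ∑ e : Fin L with K ≤ e.val, (bad 1 e).indicator (fun _ => (1 : ℝ)) ω +
      ∑ b : Fin L with b.val < K, (bad (-1) b).indicator (fun _ => missCost K p b) ω) ∂μ =
      ∑ e : Fin L with K ≤ e.val, ∫ ω, obsProb p (play sel σ W Z (t + 1) ω) e *
        G e ((run sel σ W Z t ω).count e) ∂μ +
      ∑ e : Fin L with K ≤ e.val, μ.real (bad 1 e) +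
      ∑ b : Fin L with b.val < K, μ.real (bad (-1) b) * missCost K p b := by
    rw [integral_add hi12 hi3, integral_add hi1 hi2,
      integral_finsetSum _ fun e _ => (hobs e).1, integral_finsetSum _ fun e _ => hi2' e,
      integral_finsetSum _ fun b _ => hi3' b]
    simp only [integral_indicator_const _ (hbadm _ _), smul_eq_mul, mul_one]
    rfl
  refine hsum.trans_le ?_
  set q := 1 / ((t + 1 : ℕ) : ℝ) ^ 2 with hq
  have hq0 : 0 ≤ q := by positivity
  have hb1 : ∑ e : Fin L with K ≤ e.val, μ.real (bad 1 e) ≤ (L - K : ℝ) * q := by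
    refine (Finset.sum_le_sum fun e _ => hbadP 1 e (by norm_num)).trans (le_of_eq ?_)
    rw [Finset.sum_const, nsmul_eq_mul, cast_card_filter_ge hKL]
  have hb2 : ∑ b : Fin L with b.val < K, μ.real (bad (-1) b) * missCost K p b ≤
      ((L - K : ℝ) + 1) * q := by
    calc _ ≤ ∑ b : Fin L with b.val < K, q * missCost K p b :=
          Finset.sum_le_sum fun b _ => mul_le_mul_of_nonneg_right (hbadP (-1) b (by norm_num))
            (missCost_nonneg hp0 hp1 b)
      _ = q * ∑ b : Fin L with b.val < K, missCost K p b := by rw [Finset.mul_sum]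
      _ ≤ q * ((L - K : ℝ) + 1) := by gcongr; exact sum_missCost_le hKL hp0 hp1
      _ = _ := mul_comm _ _
  have hb3 : (2 * (L - K : ℝ) + 1) / ((t + 1 : ℕ) : ℝ) ^ 2 = (L - K : ℝ) * q + ((L - K : ℝ) + 1) * q := by
    rw [hq]; ring
  have hb4 : ∑ e : Fin L with K ≤ e.val, ∫ ω, obsProb p (play sel σ W Z (t + 1) ω) e *
        G e ((run sel σ W Z t ω).count e) ∂μ = ∑ e : Fin L with K ≤ e.val,
        ∫ ω, (if Observed (play sel σ W Z (t + 1) ω) (fun e => W (t + 1) e ω) e then 1 else 0) *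
          G e ((run sel σ W Z t ω).count e) ∂μ :=
    Finset.sum_congr rfl fun e _ => (hobs e).2.2
  rw [hb3, hb4]
  linarith

end IsModel

/-! ### Summation over the rounds. -/

lemma sum_inv_sq_le {T : ℕ} (hT : 1 ≤ T) :
    ∑ t ∈ Finset.Ico 1 T, 1 / ((t + 1 : ℕ) : ℝ) ^ 2 ≤ 1 - 1 / (T : ℝ) := by
  induction T, hT using Nat.le_induction with
  | base => simp
  | succ n hn ih =>
    rw [Finset.sum_Ico_succ_top hn]
    have hn' : (0 : ℝ) < n := by exact_mod_cast hn
    have : 1 / ((n + 1 : ℕ) : ℝ) ^ 2 ≤ 1 / n - 1 / ((n + 1 : ℕ) : ℝ) := by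
      push_cast
      rw [div_sub_div _ _ (by positivity) (by positivity), div_le_div_iff₀ (by positivity)
        (by positivity)]
      nlinarith
    linarith

namespace IsModel

theorem integral_cumulativeRegret_le [IsProbabilityMeasure μ] (h : IsModel μ wbar σ W Z) (hσ : 0 < σ)
    (hsel : IsTopKRule sel) (hK : 1 ≤ K) (hKL : K ≤ L) (hw : Antitone wbar)
    (hgap : ∀ e : Fin L, K ≤ e.val → 0 < gap wbar e (kth hK hKL)) (Astar : Fin K ↪ Fin L)
    {T : ℕ} (hT : 1 < T) :
    Integrable (cumulativeRegret sel σ W Z Astar T) μ ∧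
      ∫ ω, cumulativeRegret sel σ W Z Astar T ω ∂μ ≤ ∑ e : Fin L with K ≤ e.val,
        2 * (2 * √1.5 + 2 * √8 * σ) ^ 2 / gap wbar e (kth hK hKL) * Real.log T := by
  classical
  have hround := h.integral_roundRegret_le hsel hKL hw Astar
  have hfun : cumulativeRegret sel σ W Z Astar T = fun ω => ∑ t ∈ Finset.range T,
      (reward Astar (fun e => W (t + 1) e ω) -
        reward (play sel σ W Z (t + 1) ω) (fun e => W (t + 1) e ω)) :=
    funext fun ω => cumulativeRegret_eq_sum_range Astar T ω
  rw [hfun]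
  refine ⟨integrable_finsetSum _ fun t _ => (hround t).1, ?_⟩
  rw [integral_finsetSum _ fun t _ => (hround t).1]
  refine (Finset.sum_le_sum fun t _ => (hround t).2).trans ?_
  set p : Fin L → ℝ := fun e => (wbar e : ℝ) with hp
  -- For `K = L` every list is a permutation of all items and has no regret. Otherwise `L - K ≥ 1`,
  -- which the absorption of the failure terms needs.
  rcases hKL.eq_or_lt with hKL' | hKL'
  · have hzero : ∀ A : Fin K ↪ Fin L, listRegret p A = 0 := by
      intro A
      subst hKL'
      have hbij : Function.Bijective A := Finite.injective_iff_bijective.1 A.injective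
      have huniv : (Finset.univ.filter fun i : Fin K => i.val < K) = Finset.univ := by simp
      rw [listRegret, huniv, hbij.prod_comp (fun e => 1 - p e), sub_self]
    simp only [hzero, integral_zero, Finset.sum_const_zero]
    refine Finset.sum_nonneg fun e he => ?_
    have : K ≤ e.val := (Finset.mem_filter.1 he).2
    exact absurd e.2 (by omega)
  set M := (2 * √1.5 + 2 * √8 * σ) ^ 2 * Real.log T with hM
  have hT' : (1 : ℝ) < T := by exact_mod_cast hT
  have hlog : 1 - 1 / (T : ℝ) ≤ Real.log T := by
    simpa using Real.one_sub_inv_le_log_of_pos (by linarith : (0 : ℝ) < T)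
  have hTinv : 1 / (T : ℝ) ≤ 1 / 2 := by
    apply one_div_le_one_div_of_le (by norm_num)
    exact_mod_cast hT
  have hlog0 : 0 < Real.log T := Real.log_pos hT'
  have hM6 : 6 * Real.log T ≤ M := by
    have h1 : (6 : ℝ) ≤ (2 * √1.5 + 2 * √8 * σ) ^ 2 := by
      have h2 : √(1.5 : ℝ) ^ 2 = 1.5 := Real.sq_sqrt (by norm_num)
      have h3 : 0 ≤ 2 * √8 * σ := by positivity
      have h4 : 0 ≤ √(1.5 : ℝ) := Real.sqrt_nonneg _
      nlinarith [mul_nonneg h3 h4]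
    exact mul_le_mul_of_nonneg_right h1 hlog0.le
  have hM0 : 0 < M := by linarith
  set I : ℕ → Fin L → ℝ := fun t e =>
    ∫ ω, (if Observed (play sel σ W Z (t + 1) ω) (fun e => W (t + 1) e ω) e then 1 else 0) *
      explorationCost M (gap wbar e (kth hK hKL)) ((run sel σ W Z t ω).count e) ∂μ with hI
  have hI0 : ∀ t e, 0 ≤ I t e := fun t e => integral_nonneg fun ω =>
    mul_nonneg (by split_ifs <;> simp) (explorationCost_nonneg _ _ _)
  have hIsum : ∀ e : Fin L, K ≤ e.val →
      ∑ t ∈ Finset.range T, I t e ≤ 2 * M / gap wbar e (kth hK hKL) - M := by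
    intro e he
    have hobs := fun t => h.integral_obsProb_mul hsel t e
      (f := explorationCost M (gap wbar e (kth hK hKL)))
      (fun s => explorationCost_nonneg _ _ s) (fun s => explorationCost_le_one _ _ s)
    simp only [hI]
    rw [← integral_finsetSum _ fun t _ => (hobs t).2.1]
    have hgap1 : gap wbar e (kth hK hKL) ≤ 1 := by
      have h1 := (wbar (kth hK hKL)).2.2
      have h2 := (wbar e).2.1
      simp only [gap]
      linarith
    refine (integral_mono (integrable_finsetSum _ fun t _ => (hobs t).2.1)
      (integrable_const (2 * M / gap wbar e (kth hK hKL) - M)) fun ω => ?_).trans_eq (by simp)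
    simp only
    rw [sum_observed_eq (sel := sel) (σ := σ) (w := fun s e => W s e ω) (z := fun s e => Z s e ω)]
    exact sum_explorationCost_le hM0 (hgap e he) hgap1 _
  -- The index `t = 0` is round `1`, where the failure bound `1 / 1 ^ 2` is void; the trivial bound
  -- `1` is used there.
  have hR : ∀ t ∈ Finset.range T, ∫ ω, listRegret p (play sel σ W Z (t + 1) ω) ∂μ ≤
      ∑ e : Fin L with K ≤ e.val, I t e +
        if t = 0 then 1 else (2 * (L - K : ℝ) + 1) * (1 / ((t + 1 : ℕ) : ℝ) ^ 2) := by
    intro t ht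
    rw [Finset.mem_range] at ht
    split_ifs with h0
    · have h1 : ∫ ω, listRegret p (play sel σ W Z (t + 1) ω) ∂μ ≤ 1 := by
        refine (integral_mono (h.integrable_play hsel t _) (integrable_const 1) fun ω =>
          listRegret_le_one (fun e => (wbar e).2.1) (fun e => (wbar e).2.2) _).trans_eq (by simp)
      have h2 : 0 ≤ ∑ e : Fin L with K ≤ e.val, I t e := Finset.sum_nonneg fun e _ => hI0 t e
      linarith
    · rw [mul_one_div]
      exact h.integral_listRegret_le hσ hsel hK hKL hw (by omega) (by omega)
  refine (Finset.sum_le_sum hR).trans ?_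
  rw [Finset.sum_add_distrib, Finset.sum_comm]
  have hm1 : (1 : ℝ) ≤ L - K := by
    have : (K : ℝ) + 1 ≤ L := by exact_mod_cast hKL'
    linarith
  have hfail : ∑ t ∈ Finset.range T,
      (if t = 0 then 1 else (2 * (L - K : ℝ) + 1) * (1 / ((t + 1 : ℕ) : ℝ) ^ 2)) ≤
      1 + (2 * (L - K : ℝ) + 1) * (1 - 1 / T) := by
    rw [Finset.range_eq_Ico, Finset.sum_eq_sum_Ico_succ_bot (by omega)]
    simp only [if_true]
    refine add_le_add le_rfl ?_
    calc _ = ∑ t ∈ Finset.Ico 1 T, (2 * (L - K : ℝ) + 1) * (1 / ((t + 1 : ℕ) : ℝ) ^ 2) :=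
          Finset.sum_congr rfl fun t ht => by
            rw [if_neg]
            have := (Finset.mem_Ico.1 ht).1
            omega
      _ = (2 * (L - K : ℝ) + 1) * ∑ t ∈ Finset.Ico 1 T, 1 / ((t + 1 : ℕ) : ℝ) ^ 2 := by
          rw [Finset.mul_sum]
      _ ≤ _ := mul_le_mul_of_nonneg_left (sum_inv_sq_le (by omega)) (by linarith)
  have hmain : ∑ e : Fin L with K ≤ e.val, ∑ t ∈ Finset.range T, I t e ≤
      ∑ e : Fin L with K ≤ e.val,
        2 * (2 * √1.5 + 2 * √8 * σ) ^ 2 / gap wbar e (kth hK hKL) * Real.log T -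
      (L - K : ℝ) * M := by
    refine (Finset.sum_le_sum fun e he => hIsum e (Finset.mem_filter.1 he).2).trans_eq ?_
    rw [Finset.sum_sub_distrib, Finset.sum_const, nsmul_eq_mul, cast_card_filter_ge hKL]
    congr 1
    refine Finset.sum_congr rfl fun e _ => ?_
    rw [hM]; ring
  -- With `m = L - K ≥ 1` and `u = 1 - 1 / T ≥ 1 / 2`, the left side is at most `2u + 3mu ≤ 5mu`,
  -- while `M ≥ 6 log T ≥ 6u`.
  have hslack : 1 + (2 * (L - K : ℝ) + 1) * (1 - 1 / T) ≤ (L - K : ℝ) * M := by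
    have h1 : (L - K : ℝ) * (6 * (1 - 1 / T)) ≤ (L - K : ℝ) * M := by
      apply mul_le_mul_of_nonneg_left _ (by linarith)
      linarith
    have h2 : (1 : ℝ) / 2 ≤ 1 - 1 / T := by linarith
    nlinarith [mul_le_mul hm1 h2 (by norm_num) (by linarith)]
  linarith

end IsModel

end Round

/-! ### The noise level in terms of the privacy parameters. -/

lemma noiseStd_pos {K : ℕ} (hK : 1 ≤ K) {ε δ : ℝ} (hε : 0 < ε) (hδ : 0 < δ) (hδ1 : δ < 1) :
    0 < noiseStd K ε δ := by
  have hK' : (0 : ℝ) < K := by exact_mod_cast hK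
  have : 0 < Real.log (1.25 / δ) := Real.log_pos (by rw [lt_div_iff₀ hδ]; linarith)
  have : 0 < √(2 * K * Real.log (1.25 / δ)) := Real.sqrt_pos.2 (by positivity)
  unfold noiseStd
  positivity

lemma two_mul_sqrt_mul_noiseStd (K : ℕ) (ε δ : ℝ) :
    2 * √8 * noiseStd K ε δ = 8 / ε * √(K * Real.log (1.25 / δ)) := by
  have h1 : √8 * √(2 * K * Real.log (1.25 / δ)) = 4 * √(K * Real.log (1.25 / δ)) := by
    rw [← Real.sqrt_mul (by norm_num), show 8 * (2 * K * Real.log (1.25 / δ)) =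
      4 ^ 2 * (K * Real.log (1.25 / δ)) by ring, Real.sqrt_mul (by norm_num),
      Real.sqrt_sq (by norm_num)]
  calc 2 * √8 * noiseStd K ε δ = 2 / ε * (√8 * √(2 * K * Real.log (1.25 / δ))) := by
        unfold noiseStd; ring
    _ = _ := by rw [h1]; ring

/-! ### The rate of the regret bound -/

/-- After `(a + b)² ≤ 2a² + 2b²`, the terms free of `δ` (the constant `12` and `log 1.25`) are
absorbed into multiples of `log (1 / δ) ≥ log (1 / δ₀) > 0`; for `12` this also uses `ε ≤ ε₀` and `K
≥ 1`. -/
lemma regretBound_le_mul_regretRate {ε₀ δ₀ : ℝ} (hδ₀ : 0 < δ₀) (hδ₀1 : δ₀ < 1) {L K : ℕ}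
    (hK : 1 ≤ K) (hKL : K ≤ L) {wbar : Fin L → unitInterval}
    (hgap : ∀ e : Fin L, K ≤ e.val → 0 < gap wbar e (kth hK hKL)) {ε δ : ℝ} (hε : 0 < ε)
    (hεε₀ : ε ≤ ε₀) (hδ : 0 < δ) (hδδ₀ : δ ≤ δ₀) {T : ℕ} (hT : 1 < T) :
    regretBound hK hKL wbar ε δ T ≤
      (24 * ε₀ ^ 2 / Real.log (1 / δ₀) + 256 * (1 + Real.log 1.25 / Real.log (1 / δ₀))) *
        regretRate hK hKL wbar ε δ T := by
  have hK' : (1 : ℝ) ≤ K := by exact_mod_cast hK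
  set l₀ := Real.log (1 / δ₀) with hl₀
  set l := Real.log (1 / δ) with hl
  have hl₀pos : 0 < l₀ := Real.log_pos (by rw [lt_div_iff₀ hδ₀]; linarith)
  have hl₀l : l₀ ≤ l := Real.log_le_log (by positivity) (one_div_le_one_div_of_le hδ hδδ₀)
  have hlog : Real.log (1.25 / δ) = Real.log 1.25 + l := by
    rw [hl, ← Real.log_mul (by norm_num) (by positivity)]; congr 1; ring
  have hlog0 : 0 < Real.log 1.25 := Real.log_pos (by norm_num)
  have hx : Real.log 1.25 ≤ Real.log 1.25 / l₀ * l := by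
    rw [div_mul_eq_mul_div, le_div_iff₀ hl₀pos]
    gcongr
  have hsq : (2 * √1.5 + 8 / ε * √(K * Real.log (1.25 / δ))) ^ 2 ≤
      (12 * ε₀ ^ 2 / l₀ + 128 * (1 + Real.log 1.25 / l₀)) * (K * l / ε ^ 2) := by
    have h1 : √(1.5 : ℝ) ^ 2 = 1.5 := Real.sq_sqrt (by norm_num)
    have h2 : √(K * Real.log (1.25 / δ)) ^ 2 = K * Real.log (1.25 / δ) :=
      Real.sq_sqrt (by rw [hlog]; nlinarith)
    have h3 : (2 * √1.5 + 8 / ε * √(K * Real.log (1.25 / δ))) ^ 2 ≤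
        2 * ((2 * √1.5) ^ 2 + (8 / ε * √(K * Real.log (1.25 / δ))) ^ 2) := add_sq_le
    rw [mul_pow, mul_pow, h1, h2, hlog] at h3
    have h4 : (12 : ℝ) ≤ 12 * ε₀ ^ 2 / l₀ * (K * l / ε ^ 2) := by
      rw [div_mul_div_comm, le_div_iff₀ (by positivity)]
      have h5 : ε ^ 2 ≤ ε₀ ^ 2 := by gcongr
      have h6 : l₀ ≤ K * l := by nlinarith
      nlinarith [mul_le_mul h5 h6 hl₀pos.le (sq_nonneg ε₀)]
    have h7 : (8 / ε) ^ 2 * (K * (Real.log 1.25 + l)) ≤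
        64 * (1 + Real.log 1.25 / l₀) * (K * l / ε ^ 2) := by
      have : (8 / ε) ^ 2 * (K * (Real.log 1.25 + l)) ≤
          (8 / ε) ^ 2 * (K * (Real.log 1.25 / l₀ * l + l)) := by gcongr
      refine this.trans_eq ?_
      rw [div_pow]
      ring
    rw [hlog]
    nlinarith
  have hlogT : 0 ≤ Real.log T := Real.log_nonneg (by exact_mod_cast hT.le)
  unfold regretBound regretRate
  rw [Finset.mul_sum]
  refine Finset.sum_le_sum fun e he => ?_
  have hg := hgap e (Finset.mem_filter.1 he).2
  rw [← mul_assoc]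
  refine mul_le_mul_of_nonneg_right ?_ hlogT
  rw [div_le_iff₀ hg]
  refine (mul_le_mul_of_nonneg_left hsq zero_le_two).trans_eq ?_
  field_simp
  ring

end

end CascadingBandit

theorem theorem6 :
    (∀ {Ω : Type*} [MeasurableSpace Ω] (μ : MeasureTheory.Measure Ω)
        [MeasureTheory.IsProbabilityMeasure μ]
        {L K : ℕ} (hK : 1 ≤ K) (hKL : K ≤ L)
        (wbar : Fin L → unitInterval) (_ : Antitone wbar)
        (_ : ∀ e : Fin L, K ≤ e.val → 0 < CascadingBandit.gap wbar e (CascadingBandit.kth hK hKL))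
        (ε δ : ℝ) (_ : 0 < ε) (_ : 0 < δ) (_ : δ < 1)
        (W Z : ℕ → Fin L → Ω → ℝ)
        (_ : CascadingBandit.IsModel μ wbar (CascadingBandit.noiseStd K ε δ) W Z)
        (sel : ℕ → (Fin L → ℝ) → (Fin K ↪ Fin L)) (_ : CascadingBandit.IsTopKRule sel)
        (Astar : Fin K ↪ Fin L) (_ : CascadingBandit.IsOptimal wbar Astar)
        (T : ℕ) (_ : 1 < T),
        MeasureTheory.Integrable
          (CascadingBandit.cumulativeRegret sel (CascadingBandit.noiseStd K ε δ) W Z Astar T) μ ∧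
        ∫ ω, CascadingBandit.cumulativeRegret sel (CascadingBandit.noiseStd K ε δ) W Z Astar T ω ∂μ
          ≤ CascadingBandit.regretBound hK hKL wbar ε δ T) ∧
    (∀ ε₀ δ₀ : ℝ, 0 < ε₀ → 0 < δ₀ → δ₀ < 1 →
      ∃ C : ℝ, 0 < C ∧
        ∀ {L K : ℕ} (hK : 1 ≤ K) (hKL : K ≤ L)
          (wbar : Fin L → unitInterval) (_ : Antitone wbar)
          (_ : ∀ e : Fin L, K ≤ e.val →
            0 < CascadingBandit.gap wbar e (CascadingBandit.kth hK hKL))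
          (ε δ : ℝ) (_ : 0 < ε) (_ : ε ≤ ε₀) (_ : 0 < δ) (_ : δ ≤ δ₀)
          (T : ℕ) (_ : 1 < T),
          CascadingBandit.regretBound hK hKL wbar ε δ T
            ≤ C * CascadingBandit.regretRate hK hKL wbar ε δ T) := by
  refine ⟨?_, ?_⟩
  · intro Ω _ μ _ L K hK hKL wbar hw hgap ε δ hε hδ hδ1 W Z hmodel sel hsel Astar _ T hT
    have key := hmodel.integral_cumulativeRegret_le
      (CascadingBandit.noiseStd_pos hK hε hδ hδ1) hsel hK hKL hw hgap Astar hT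
    rw [CascadingBandit.two_mul_sqrt_mul_noiseStd] at key
    exact key
  · intro ε₀ δ₀ hε₀ hδ₀ hδ₀1
    refine ⟨24 * ε₀ ^ 2 / Real.log (1 / δ₀) +
      256 * (1 + Real.log 1.25 / Real.log (1 / δ₀)), ?_, ?_⟩
    · have h1 : 0 < Real.log (1 / δ₀) := Real.log_pos (by rw [lt_div_iff₀ hδ₀]; linarith)
      have h2 : 0 < Real.log 1.25 := Real.log_pos (by norm_num)
      positivity
    · intro L K hK hKL wbar _ hgap ε δ hε hεε₀ hδ hδδ₀ T hT
      exact CascadingBandit.regretBound_le_mul_regretRate hδ₀ hδ₀1 hK hKL hgap hε hεε₀ hδ hδδ₀ hT
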